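/- Let $H_4$ be the Nappi-Witten Lie algebra: the complex Lie algebra with basis $a,b,c,d$ and brackets $[a,b]=c$, $[d,a]=a$, $[d,b]=-b$, $c$ central. Equip it with the symmetric bilinear form with $(a,b)=(c,d)=1$ and all other pairings of basis vectors zero, and with the automorphism $\tau$ given by $\tau a=b$, $\tau b=a$, $\tau c=-c$, $\tau d=-d$. Let $\widehat H_4=H_4\otimes\mathbb C[t,t^{-1}]\oplus\mathbb C\mathbf k$ with $\mathbf k$ central and $$[x\otimes t^m,y\otimes t^n]=[x,y]\otimes t^{m+n}+m(x,y)\delta_{m+n,0}\mathbf k ,$$ write $x(n)=x\otimes t^n$, and let $\widehat H_4[\tau]$ be the Lie subalgebra of fixed points of the automorphism $\hat\tau(x\otimes t^m+s\mathbf k)=(-1)^m\tau(x)\otimes t^m+s\mathbf k$. Let $\widehat H_4[\tau]^{(+)}$ be the Lie subalgebra of $\widehat H_4[\tau]$ spanned by $(a+b)(n)$ for $n>0$ even and by $(a-b)(m)$, $c(m)$, $d(m)$ for $m>0$ odd. Let $\psi:\widehat H_4[\tau]^{(+)}\to\mathbb C$ be a Lie algebra homomorphism and let $\xi\in\mathbb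 C$. Let $\mathbb C_\psi$ be the one-dimensional $\widehat H_4[\tau]^{(+)}$-module on which $x$ acts as $\psi(x)$, and set $$M_\psi=U(\widehat H_4[\tau])\otimes_{U(\widehat H_4[\tau]^{(+)})}\mathbb C_\psi,\qquad L_{\psi,\xi}=M_\psi/(\mathbf k-\xi)M_\psi ,$$ and let $\bar\omega\in L_{\psi,\xi}$ be the image of $1\otimes 1$. A Whittaker vector (of type $\psi$) of an $\widehat H_4[\tau]$-module is a nonzero vector $v$ with $xv=\psi(x)v$ for all $x\in\widehat H_4[\tau]^{(+)}$. **Theorem.** Suppose that $\psi(c(1))=0$ and $\xi\neq 0$. Put $\sigma_1=\psi((a-b)(1))$, and in $U(\widehat H_4[\tau])$ put $$z=\begin{cases}(a+b)(0), & \sigma_1=0,\\ \xi\,(a+b)(0)-\sigma_1c(-1), & \sigma_1\neq 0.\end{cases}$$ Then a vector $v\in L_{\psi,\xi}$ is a Whittaker vector of type $\psi$ if and only if $v\neq 0$ and $v=u\bar\omega$ for some $u\in\mathbb C[z]$, where $\mathbb C[z]\subseteq U(\widehat H_4[\tau])$ is the subalgebra generated by $z$. -/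

import Mathlib

noncomputable section

open scoped TensorProduct

/-! ### The Nappi-Witten Lie algebra -/

/-- The underlying space of the Nappi-Witten Lie algebra `H₄`: an element is the vector of its
coordinates in the basis `a, b, c, d` (in this order). -/
def NappiWitten : Type := Fin 4 → ℂ

namespace NappiWitten

instance : AddCommGroup NappiWitten := inferInstanceAs (AddCommGroup (Fin 4 → ℂ))
instance : Module ℂ NappiWitten := inferInstanceAs (Module ℂ (Fin 4 → ℂ))

@[ext] theorem ext {x y : NappiWitten} (h0 : x 0 = y 0) (h1 : x 1 = y 1) (h2 : x 2 = y 2)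
    (h3 : x 3 = y 3) : x = y := by
  funext i
  fin_cases i
  exacts [h0, h1, h2, h3]

@[simp] theorem add_apply (x y : NappiWitten) (i : Fin 4) : (x + y) i = x i + y i := rfl
@[simp] theorem sub_apply (x y : NappiWitten) (i : Fin 4) : (x - y) i = x i - y i := rfl
@[simp] theorem neg_apply (x : NappiWitten) (i : Fin 4) : (-x) i = -x i := rfl
@[simp] theorem smul_apply (r : ℂ) (x : NappiWitten) (i : Fin 4) : (r • x) i = r * x i := rfl
@[simp] theorem zero_apply (i : Fin 4) : (0 : NappiWitten) i = 0 := rfl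

/-- The element `p a + q b + r c + s d`. -/
def mk (p q r s : ℂ) : NappiWitten := (![p, q, r, s] : Fin 4 → ℂ)

@[simp] theorem mk_apply_zero (p q r s : ℂ) : mk p q r s 0 = p := rfl
@[simp] theorem mk_apply_one (p q r s : ℂ) : mk p q r s 1 = q := rfl
@[simp] theorem mk_apply_two (p q r s : ℂ) : mk p q r s 2 = r := rfl
@[simp] theorem mk_apply_three (p q r s : ℂ) : mk p q r s 3 = s := rfl

/-- The basis vector `a`. -/
def a : NappiWitten := mk 1 0 0 0
/-- The basis vector `b`. -/
def b : NappiWitten := mk 0 1 0 0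
/-- The basis vector `c`. -/
def c : NappiWitten := mk 0 0 1 0
/-- The basis vector `d`. -/
def d : NappiWitten := mk 0 0 0 1

/-- The bracket determined by `[a,b] = c`, `[d,a] = a`, `[d,b] = -b` and `c` central. -/
instance : Bracket NappiWitten NappiWitten where
  bracket x y := mk (x 3 * y 0 - x 0 * y 3) (x 1 * y 3 - x 3 * y 1) (x 0 * y 1 - x 1 * y 0) 0

theorem lie_def (x y : NappiWitten) :
    ⁅x, y⁆ = mk (x 3 * y 0 - x 0 * y 3) (x 1 * y 3 - x 3 * y 1) (x 0 * y 1 - x 1 * y 0) 0 := rfl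

instance : LieRing NappiWitten where
  add_lie x y z := by
    ext <;> simp [lie_def] <;> try ring
  lie_add x y z := by
    ext <;> simp [lie_def] <;> try ring
  lie_self x := by
    ext <;> simp [lie_def] <;> try ring
  leibniz_lie x y z := by
    ext <;> simp [lie_def] <;> try ring

instance : LieAlgebra ℂ NappiWitten where
  lie_smul t x y := by
    ext <;> simp [lie_def] <;> try ring

theorem lie_a_b : ⁅a, b⁆ = c := by
  ext <;> simp [lie_def, a, b, c]
theorem lie_d_a : ⁅d, a⁆ = a := by
  ext <;> simp [lie_def, a, d]
theorem lie_d_b : ⁅d, b⁆ = -b := by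
  ext <;> simp [lie_def, b, d]
theorem lie_c (x : NappiWitten) : ⁅c, x⁆ = 0 := by
  ext <;> simp [lie_def, c]

/-- The symmetric bilinear form with `(a,b) = (c,d) = 1` and all other pairings of basis
vectors (up to symmetry) equal to `0`. -/
def form : LinearMap.BilinForm ℂ NappiWitten :=
  LinearMap.mk₂ ℂ (fun x y => x 0 * y 1 + x 1 * y 0 + x 2 * y 3 + x 3 * y 2)
    (fun x y z => by simp; ring) (fun r x y => by simp; ring)
    (fun x y z => by simp; ring) (fun r x y => by simp; ring)

theorem form_apply (x y : NappiWitten) :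
    form x y = x 0 * y 1 + x 1 * y 0 + x 2 * y 3 + x 3 * y 2 := rfl

theorem form_isSymm : form.IsSymm := ⟨fun x y => by simp [form_apply]; ring⟩

theorem form_lieInvariant : form.lieInvariant NappiWitten := by
  intro x y z
  simp [form_apply, lie_def]
  ring

/-- The involution `τ`: `τ a = b`, `τ b = a`, `τ c = -c`, `τ d = -d`. -/
def tau : NappiWitten →ₗ⁅ℂ⁆ NappiWitten where
  toFun x := mk (x 1) (x 0) (-x 2) (-x 3)
  map_add' x y := by ext <;> simp <;> try ring
  map_smul' r x := by ext <;> simp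
  map_lie' {x y} := by ext <;> simp [lie_def] <;> try ring

theorem tau_apply (x : NappiWitten) : tau x = mk (x 1) (x 0) (-x 2) (-x 3) := rfl

end NappiWitten

/-! ### The affine Nappi-Witten Lie algebra -/

open NappiWitten

/-- The loop algebra `ℂ[t, t⁻¹] ⊗ H₄`; the element `x ⊗ tᵐ` is `single m 1 ⊗ₜ x`. -/
abbrev LoopNW : Type := LieAlgebra.loopAlgebra ℂ ℤ NappiWitten

/-- The two-cocycle with `(x ⊗ tᵐ, y ⊗ tⁿ) ↦ m (x, y) δ_{m+n,0}`. (Mathlib's cocycle has the factor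
`n` in place of `m`, and `n = -m` where it does not vanish; hence the form `-(x, y)`.) -/
def affineCocycle : LieModule.Cohomology.twoCocycle ℂ LoopNW (TrivialLieModule ℂ LoopNW ℂ) :=
  LieAlgebra.LoopAlgebra.twoCocycleOfBilinear ℂ ℤ NappiWitten (-form)
    (fun x y z => by simp [form_lieInvariant x y z])
    ⟨fun x y => by simp [form_isSymm.eq x y]⟩

/-- The affine Nappi-Witten Lie algebra `Ĥ₄ = H₄ ⊗ ℂ[t, t⁻¹] ⊕ ℂ k`, the central extension of the
loop algebra by `affineCocycle`. -/
abbrev AffineNW : Type := LieAlgebra.ofTwoCocycle affineCocycle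

namespace AffineNW

/-- The element `u + s k` of `Ĥ₄`, for `u` in the loop algebra and `s` a scalar. -/
def mk (u : LoopNW) (s : ℂ) : AffineNW := LieAlgebra.ofProd affineCocycle (u, s)

/-- The component in the loop algebra of an element of `Ĥ₄`. -/
def fst (w : AffineNW) : LoopNW := ((LieAlgebra.ofProd affineCocycle).symm w).1

/-- The coefficient of `k` of an element of `Ĥ₄`. -/
def snd (w : AffineNW) : ℂ := ((LieAlgebra.ofProd affineCocycle).symm w).2

@[simp] theorem fst_mk (u : LoopNW) (s : ℂ) : fst (mk u s) = u := rfl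
@[simp] theorem snd_mk (u : LoopNW) (s : ℂ) : snd (mk u s) = s := rfl
theorem mk_fst_snd (w : AffineNW) : mk (fst w) (snd w) = w := rfl
theorem mk_add_mk (u v : LoopNW) (s t : ℂ) : mk u s + mk v t = mk (u + v) (s + t) := rfl
theorem smul_mk (r : ℂ) (u : LoopNW) (s : ℂ) : r • mk u s = mk (r • u) (r * s) := rfl
theorem mk_zero : mk 0 0 = 0 := rfl
theorem fst_add (w w' : AffineNW) : fst (w + w') = fst w + fst w' := rfl
theorem snd_add (w w' : AffineNW) : snd (w + w') = snd w + snd w' := rfl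
theorem fst_smul (r : ℂ) (w : AffineNW) : fst (r • w) = r • fst w := rfl
theorem snd_smul (r : ℂ) (w : AffineNW) : snd (r • w) = r * snd w := rfl

/-- The bilinear form `(x ⊗ tᵐ, y ⊗ tⁿ) ↦ m (x, y) δ_{m+n,0}` on the loop algebra. -/
def pairing : LinearMap.BilinForm ℂ LoopNW :=
  LieAlgebra.LoopAlgebra.residuePairing ℂ ℤ NappiWitten (-form)

theorem pairing_single (x y : NappiWitten) (m n : ℤ) :
    pairing (AddMonoidAlgebra.single m (1 : ℂ) ⊗ₜ[ℂ] x)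
      (AddMonoidAlgebra.single n (1 : ℂ) ⊗ₜ[ℂ] y) =
      if m + n = 0 then (m : ℂ) * form x y else 0 := by
  rw [pairing, LieAlgebra.LoopAlgebra.residuePairing_apply_apply]
  rw [LieAlgebra.LoopAlgebra.toFinsupp_single_tmul, LieAlgebra.LoopAlgebra.toFinsupp_single_tmul]
  rw [Finsupp.sum_single_index (by simp)]
  split_ifs with h
  · obtain rfl : n = -m := by omega
    simp
  · rw [Finsupp.single_eq_of_ne (by omega)]
    simp

theorem lie_mk_mk (u v : LoopNW) (s t : ℂ) :
    ⁅mk u s, mk v t⁆ = mk ⁅u, v⁆ (pairing u v) := by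
  have h : pairing u v + 0 - 0 = pairing u v := by rw [add_zero, sub_zero]
  exact congrArg (fun r : ℂ => mk ⁅u, v⁆ r) h

/-- The element `x(n) = x ⊗ tⁿ` of `Ĥ₄`. -/
def loop (x : NappiWitten) (n : ℤ) : AffineNW :=
  mk (AddMonoidAlgebra.single n (1 : ℂ) ⊗ₜ[ℂ] x) 0

/-- The central element `k` of `Ĥ₄`. -/
def central : AffineNW := mk 0 1

theorem loop_add (x y : NappiWitten) (n : ℤ) : loop (x + y) n = loop x n + loop y n := by
  rw [loop, loop, loop, mk_add_mk, TensorProduct.tmul_add, add_zero]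

theorem loop_smul (r : ℂ) (x : NappiWitten) (n : ℤ) : loop (r • x) n = r • loop x n := by
  rw [loop, loop, smul_mk, TensorProduct.tmul_smul, mul_zero]

theorem lie_loop_loop (x y : NappiWitten) (m n : ℤ) :
    ⁅loop x m, loop y n⁆ =
      loop ⁅x, y⁆ (m + n) + (if m + n = 0 then (m : ℂ) * form x y else 0) • central := by
  rw [loop, loop, lie_mk_mk, pairing_single, loop, central, LieAlgebra.ExtendScalars.bracket_tmul,
    AddMonoidAlgebra.single_mul_single, one_mul, smul_mk, mk_add_mk, smul_zero, add_zero, zero_add,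
    mul_one]

theorem lie_central (w : AffineNW) : ⁅w, central⁆ = 0 := by
  rw [← mk_fst_snd w, central, lie_mk_mk, map_zero, ← mk_zero]
  exact congrArg (fun u => mk u 0) (lie_zero (L := LoopNW) (M := LoopNW) (fst w))

/-- The automorphism `tᵐ ↦ (-1)ᵐ tᵐ` of `ℂ[t, t⁻¹]`. -/
def signTwist : AddMonoidAlgebra ℂ ℤ →ₐ[ℂ] AddMonoidAlgebra ℂ ℤ :=
  AddMonoidAlgebra.lift ℂ (AddMonoidAlgebra ℂ ℤ) ℤ
    { toFun m := AddMonoidAlgebra.single m.toAdd ((-1 : ℂ) ^ m.toAdd)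
      map_one' := by rw [toAdd_one, zpow_zero, AddMonoidAlgebra.one_def]
      map_mul' m n := by
        rw [AddMonoidAlgebra.single_mul_single, toAdd_mul,
          zpow_add₀ (by norm_num : (-1 : ℂ) ≠ 0)] }

theorem signTwist_single (m : ℤ) :
    signTwist (AddMonoidAlgebra.single m (1 : ℂ)) = AddMonoidAlgebra.single m ((-1 : ℂ) ^ m) := by
  rw [signTwist, AddMonoidAlgebra.lift_single, one_smul]
  rfl

/-- The automorphism `x ⊗ tᵐ ↦ (-1)ᵐ τ(x) ⊗ tᵐ` of the loop algebra. -/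
def tauLoop : LoopNW →ₗ⁅ℂ⁆ LoopNW := LieAlgebra.ExtendScalars.map signTwist tau

theorem tauLoop_single (x : NappiWitten) (m : ℤ) :
    tauLoop (AddMonoidAlgebra.single m (1 : ℂ) ⊗ₜ[ℂ] x) =
      (-1 : ℂ) ^ m • (AddMonoidAlgebra.single m (1 : ℂ) ⊗ₜ[ℂ] tau x) := by
  rw [tauLoop, LieAlgebra.ExtendScalars.map_apply_tmul, signTwist_single, TensorProduct.smul_tmul',
    AddMonoidAlgebra.smul_single, smul_eq_mul, mul_one]

theorem form_tau (x y : NappiWitten) : form (tau x) (tau y) = form x y := by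
  simp [form_apply, tau_apply]
  ring

theorem loop_induction {p : LoopNW → Prop} (h0 : p 0) (hadd : ∀ u v, p u → p v → p (u + v))
    (hs : ∀ (r : ℂ) (x : NappiWitten) (m : ℤ),
      p (r • (AddMonoidAlgebra.single m (1 : ℂ) ⊗ₜ[ℂ] x))) (u : LoopNW) : p u := by
  induction u using TensorProduct.induction_on with
  | zero => exact h0
  | add u v hu hv => exact hadd u v hu hv
  | tmul f x =>
    induction f using AddMonoidAlgebra.induction_linear with
    | zero => rw [TensorProduct.zero_tmul]; exact h0
    | add f g hf hg => rw [TensorProduct.add_tmul]; exact hadd _ _ hf hg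
    | single m r =>
      have := hs r x m
      rwa [TensorProduct.smul_tmul', AddMonoidAlgebra.smul_single, smul_eq_mul, mul_one] at this

theorem pairing_tauLoop (u v : LoopNW) : pairing (tauLoop u) (tauLoop v) = pairing u v := by
  induction u using loop_induction with
  | h0 => simp only [map_zero, LinearMap.zero_apply]
  | hadd u u' hu hu' => simp only [map_add, LinearMap.add_apply, hu, hu']
  | hs r x m =>
    induction v using loop_induction with
    | h0 => simp only [map_zero]
    | hadd v v' hv hv' => simp only [map_add, hv, hv']
    | hs q y n =>
      simp only [map_smul, LinearMap.smul_apply, tauLoop_single, pairing_single, form_tau]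
      split_ifs with h
      · have hmn : (-1 : ℂ) ^ n * (-1 : ℂ) ^ m = 1 := by
          rw [← zpow_add₀ (by norm_num : (-1 : ℂ) ≠ 0), add_comm, h, zpow_zero]
        simp only [smul_eq_mul]
        linear_combination (q * r * m * form x y) * hmn
      · simp

/-- The automorphism `τ̂ (x ⊗ tᵐ + s k) = (-1)ᵐ τ(x) ⊗ tᵐ + s k` of `Ĥ₄`. -/
def tauHat : AffineNW →ₗ⁅ℂ⁆ AffineNW where
  toFun w := mk (tauLoop (fst w)) (snd w)
  map_add' w w' := by rw [fst_add, snd_add, map_add, mk_add_mk]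
  map_smul' r w := by rw [fst_smul, snd_smul, map_smul, RingHom.id_apply, smul_mk]
  map_lie' {w w'} := by
    rw [lie_mk_mk, pairing_tauLoop, ← LieHom.map_lie, ← mk_fst_snd w, ← mk_fst_snd w', lie_mk_mk]
    simp only [fst_mk, snd_mk]

theorem tauHat_mk (u : LoopNW) (s : ℂ) : tauHat (mk u s) = mk (tauLoop u) s := rfl

theorem tauHat_loop (x : NappiWitten) (m : ℤ) :
    tauHat (loop x m) = (-1 : ℂ) ^ m • loop (tau x) m := by
  rw [loop, tauHat_mk, tauLoop_single, loop, smul_mk, mul_zero]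

theorem tauHat_central : tauHat central = central := by
  rw [central, tauHat_mk, map_zero]

end AffineNW

/-! ### The twisted affine Nappi-Witten Lie algebra -/

open AffineNW

/-- The twisted affine Nappi-Witten Lie algebra `Ĥ₄[τ]`: the fixed points of `τ̂` in `Ĥ₄`. -/
def twistedNW : LieSubalgebra ℂ AffineNW where
  carrier := {w | tauHat w = w}
  add_mem' {w w'} h h' := by
    change tauHat (w + w') = w + w'
    rw [map_add, show tauHat w = w from h, show tauHat w' = w' from h']
  zero_mem' := map_zero tauHat
  smul_mem' r w h := by
    change tauHat (r • w) = r • w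
    rw [map_smul, show tauHat w = w from h]
  lie_mem' {w w'} h h' := by
    change tauHat ⁅w, w'⁆ = ⁅w, w'⁆
    rw [LieHom.map_lie, show tauHat w = w from h, show tauHat w' = w' from h']

namespace TwistedNW

theorem loop_mem (x : NappiWitten) (n : ℤ) (h : tau x = (-1 : ℂ) ^ n • x) :
    loop x n ∈ twistedNW := by
  change tauHat (loop x n) = loop x n
  rw [tauHat_loop, h, loop_smul, smul_smul, ← zpow_add₀ (by norm_num), Even.neg_one_zpow ⟨n, rfl⟩,
    one_smul]

theorem tau_a_add_b : tau (a + b) = a + b := by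
  ext <;> simp [tau_apply, a, b]
theorem tau_a_sub_b : tau (a - b) = -(a - b) := by
  ext <;> simp [tau_apply, a, b]
theorem tau_c : tau c = -c := by
  ext <;> simp [tau_apply, c]
theorem tau_d : tau d = -d := by
  ext <;> simp [tau_apply, d]

/-- `(a+b)(n)` for even `n`. -/
def apb (n : ℤ) (hn : Even n) : twistedNW :=
  ⟨loop (a + b) n, loop_mem _ _ (by rw [tau_a_add_b, hn.neg_one_zpow, one_smul])⟩

/-- `(a-b)(n)` for odd `n`. -/
def amb (n : ℤ) (hn : Odd n) : twistedNW :=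
  ⟨loop (a - b) n, loop_mem _ _ (by rw [tau_a_sub_b, hn.neg_one_zpow, neg_one_smul])⟩

/-- `c(n)` for odd `n`. -/
def cc (n : ℤ) (hn : Odd n) : twistedNW :=
  ⟨loop c n, loop_mem _ _ (by rw [tau_c, hn.neg_one_zpow, neg_one_smul])⟩

/-- `d(n)` for odd `n`. -/
def dd (n : ℤ) (hn : Odd n) : twistedNW :=
  ⟨loop d n, loop_mem _ _ (by rw [tau_d, hn.neg_one_zpow, neg_one_smul])⟩

/-- The central element `k` of `Ĥ₄[τ]`. -/
def kk : twistedNW := ⟨central, tauHat_central⟩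

/-- The spanning vectors `(a+b)(n)`, `(a-b)(m)`, `c(m)`, `d(m)` of `Ĥ₄[τ]⁽⁺⁾`, where `n > 0` is
even and `m > 0` is odd. -/
inductive IsPositiveGenerator : twistedNW → Prop
  | apb (n : ℤ) (hn : Even n) (hpos : 0 < n) : IsPositiveGenerator (apb n hn)
  | amb (m : ℤ) (hm : Odd m) (hpos : 0 < m) : IsPositiveGenerator (amb m hm)
  | cc (m : ℤ) (hm : Odd m) (hpos : 0 < m) : IsPositiveGenerator (cc m hm)
  | dd (m : ℤ) (hm : Odd m) (hpos : 0 < m) : IsPositiveGenerator (dd m hm)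

theorem loop_mem_span (x : NappiWitten) (n : ℤ) (h : tau x = (-1 : ℂ) ^ n • x) (hpos : 0 < n) :
    (⟨loop x n, loop_mem x n h⟩ : twistedNW) ∈ Submodule.span ℂ {w | IsPositiveGenerator w} := by
  rcases Int.even_or_odd n with hn | hn
  · have h' := h
    rw [hn.neg_one_zpow, one_smul] at h'
    have hx : x = x 0 • (a + b) := by
      have h0 := congrFun h' 0
      have h1 := congrFun h' 1
      have h2 := congrFun h' 2
      have h3 := congrFun h' 3
      simp only [tau_apply, mk_apply_zero, mk_apply_one, mk_apply_two, mk_apply_three] at h0 h1 h2 h3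
      have h2' : x 2 = 0 := by linear_combination (-1 / 2 : ℂ) * h2
      have h3' : x 3 = 0 := by linear_combination (-1 / 2 : ℂ) * h3
      ext <;> simp [a, b, h0, h2', h3']
    have : (⟨loop x n, loop_mem x n h⟩ : twistedNW) = x 0 • apb n hn := by
      apply Subtype.ext
      change loop x n = x 0 • loop (a + b) n
      rw [← loop_smul, ← hx]
    rw [this]
    exact Submodule.smul_mem _ _ (Submodule.subset_span (.apb n hn hpos))
  · have h' := h
    rw [hn.neg_one_zpow, neg_one_smul] at h'
    have hx : x = x 0 • (a - b) + x 2 • c + x 3 • d := by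
      have h0 := congrFun h' 0
      have h1 := congrFun h' 1
      simp only [tau_apply, mk_apply_zero, mk_apply_one, neg_apply] at h0 h1
      have h1' : x 1 = -x 0 := by linear_combination h0
      ext <;> simp [a, b, c, d, h1']
    have : (⟨loop x n, loop_mem x n h⟩ : twistedNW) =
        x 0 • amb n hn + x 2 • cc n hn + x 3 • dd n hn := by
      apply Subtype.ext
      change loop x n = x 0 • loop (a - b) n + x 2 • loop c n + x 3 • loop d n
      rw [← loop_smul, ← loop_smul, ← loop_smul, ← loop_add, ← loop_add, ← hx]
    rw [this]
    exact Submodule.add_mem _ (Submodule.add_mem _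
      (Submodule.smul_mem _ _ (Submodule.subset_span (.amb n hn hpos)))
      (Submodule.smul_mem _ _ (Submodule.subset_span (.cc n hn hpos))))
      (Submodule.smul_mem _ _ (Submodule.subset_span (.dd n hn hpos)))

theorem IsPositiveGenerator.exists_loop {w : twistedNW} (h : IsPositiveGenerator w) :
    ∃ (x : NappiWitten) (n : ℤ), tau x = (-1 : ℂ) ^ n • x ∧ 0 < n ∧ (w : AffineNW) = loop x n := by
  cases h with
  | apb n hn hpos =>
    exact ⟨_, n, by rw [tau_a_add_b, hn.neg_one_zpow, one_smul], hpos, rfl⟩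
  | amb n hn hpos =>
    exact ⟨_, n, by rw [tau_a_sub_b, hn.neg_one_zpow, neg_one_smul], hpos, rfl⟩
  | cc n hn hpos => exact ⟨_, n, by rw [tau_c, hn.neg_one_zpow, neg_one_smul], hpos, rfl⟩
  | dd n hn hpos => exact ⟨_, n, by rw [tau_d, hn.neg_one_zpow, neg_one_smul], hpos, rfl⟩

theorem lie_mem_span {w w' : twistedNW}
    (h : w ∈ Submodule.span ℂ {w | IsPositiveGenerator w})
    (h' : w' ∈ Submodule.span ℂ {w | IsPositiveGenerator w}) :
    ⁅w, w'⁆ ∈ Submodule.span ℂ {w | IsPositiveGenerator w} := by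
  induction h, h' using Submodule.span_induction₂ with
  | mem_mem w w' h h' =>
    obtain ⟨x, m, hx, hm, hw⟩ := h.exists_loop
    obtain ⟨y, n, hy, hn, hw'⟩ := h'.exists_loop
    have hxy : tau ⁅x, y⁆ = (-1 : ℂ) ^ (m + n) • ⁅x, y⁆ := by
      rw [LieHom.map_lie, hx, hy, smul_lie, lie_smul, smul_smul, zpow_add₀ (by norm_num)]
    have : ⁅w, w'⁆ = ⟨loop ⁅x, y⁆ (m + n), loop_mem _ _ hxy⟩ := by
      apply Subtype.ext
      rw [LieSubalgebra.coe_bracket, hw, hw', lie_loop_loop, if_neg (by omega), zero_smul, add_zero]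
    rw [this]
    exact loop_mem_span _ _ hxy (by omega)
  | zero_left w' _ => rw [zero_lie]; exact Submodule.zero_mem _
  | zero_right w _ => rw [lie_zero]; exact Submodule.zero_mem _
  | add_left u v w _ _ _ hu hv => rw [add_lie]; exact Submodule.add_mem _ hu hv
  | add_right u v w _ _ _ hu hv => rw [lie_add]; exact Submodule.add_mem _ hu hv
  | smul_left r u v _ _ hu => rw [smul_lie]; exact Submodule.smul_mem _ _ hu
  | smul_right r u v _ _ hu => rw [lie_smul]; exact Submodule.smul_mem _ _ hu

/-- The subalgebra `Ĥ₄[τ]⁽⁺⁾`: the linear span of `(a+b)(n)`, `(a-b)(m)`, `c(m)`, `d(m)` with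
`n > 0` even and `m > 0` odd. -/
def positivePart : LieSubalgebra ℂ twistedNW where
  toSubmodule := Submodule.span ℂ {w | IsPositiveGenerator w}
  lie_mem' := lie_mem_span

/-- `c(1)` as an element of `Ĥ₄[τ]⁽⁺⁾`. -/
def c1 : positivePart :=
  ⟨cc 1 odd_one, Submodule.subset_span (.cc 1 odd_one one_pos)⟩

/-- `(a-b)(1)` as an element of `Ĥ₄[τ]⁽⁺⁾`. -/
def amb1 : positivePart :=
  ⟨amb 1 odd_one, Submodule.subset_span (.amb 1 odd_one one_pos)⟩

end TwistedNW

/-! ### Whittaker vectors and Whittaker modules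

Modules over a Lie algebra are taken to be left modules over its universal enveloping algebra. -/

section Whittaker

open UniversalEnvelopingAlgebra

attribute [local instance] LieRing.ofAssociativeRing

variable {L : Type} [LieRing L] [LieAlgebra ℂ L] (n : LieSubalgebra ℂ L)

/-- The algebra homomorphism `U(n) → U(L)` induced by the inclusion of a Lie subalgebra `n`. -/
def envelopingIncl : UniversalEnvelopingAlgebra ℂ n →ₐ[ℂ] UniversalEnvelopingAlgebra ℂ L :=
  lift ℂ ((ι ℂ).comp n.incl)

variable {n} (ψ : LieAlgebra.LieCharacter ℂ n)

/-- The action of `U(n)` on the one-dimensional module `ℂ_ψ` on which `x ∈ n` acts by `ψ x`. -/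
def characterAction : UniversalEnvelopingAlgebra ℂ n →ₐ[ℂ] ℂ := lift ℂ ψ

/-- A nonzero vector `v` is a Whittaker vector of type `ψ` if `x v = ψ(x) v` for all `x ∈ n`. -/
def IsWhittakerVector {M : Type} [AddCommGroup M] [Module ℂ M]
    [Module (UniversalEnvelopingAlgebra ℂ L) M]
    [IsScalarTower ℂ (UniversalEnvelopingAlgebra ℂ L) M] (v : M) : Prop :=
  v ≠ 0 ∧ ∀ x : n, ι ℂ (x : L) • v = ψ x • v

/-- The relations `(u y) ⊗ α = u ⊗ (y α)`, for `y ∈ U(n)`, which cut out the tensor product over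
`U(n)` from the tensor product over `ℂ`. -/
def balancedRelations :
    Submodule (UniversalEnvelopingAlgebra ℂ L) (UniversalEnvelopingAlgebra ℂ L ⊗[ℂ] ℂ) :=
  Submodule.span _ {w | ∃ (u : UniversalEnvelopingAlgebra ℂ L)
    (y : UniversalEnvelopingAlgebra ℂ n) (α : ℂ),
    w = (u * envelopingIncl n y) ⊗ₜ[ℂ] α - u ⊗ₜ[ℂ] (characterAction ψ y * α)}

/-- The universal Whittaker module `M_ψ = U(L) ⊗_{U(n)} ℂ_ψ`. -/
abbrev UniversalWhittaker : Type :=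
  (UniversalEnvelopingAlgebra ℂ L ⊗[ℂ] ℂ) ⧸ balancedRelations ψ

/-- The submodule `(k - ξ) M_ψ` of `M_ψ`, for an element `k` of `L` (which will be central, so that
the span is not needed). -/
def centralSubmodule (k : L) (ξ : ℂ) :
    Submodule (UniversalEnvelopingAlgebra ℂ L) (UniversalWhittaker ψ) :=
  Submodule.span _ (Set.range fun m : UniversalWhittaker ψ =>
    (ι ℂ k - algebraMap ℂ (UniversalEnvelopingAlgebra ℂ L) ξ) • m)

end Whittaker

/-! ### The Whittaker modules of the twisted affine Nappi-Witten Lie algebra -/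

open TwistedNW

/-- The quotient `L_{ψ,ξ} = M_ψ / (k - ξ) M_ψ`. -/
abbrev WhittakerQuotient (ψ : LieAlgebra.LieCharacter ℂ positivePart) (ξ : ℂ) : Type :=
  UniversalWhittaker ψ ⧸ centralSubmodule ψ kk ξ

/-- The cyclic Whittaker vector `ω̄`, the class of `1 ⊗ 1`. -/
def omegaBar (ψ : LieAlgebra.LieCharacter ℂ positivePart) (ξ : ℂ) : WhittakerQuotient ψ ξ :=
  Submodule.Quotient.mk (Submodule.Quotient.mk (1 ⊗ₜ[ℂ] 1))

open Classical in
/-- The element `z`, with `σ₁ = ψ((a-b)(1))`: it is `(a+b)(0)` if `σ₁ = 0`, and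
`ξ (a+b)(0) - σ₁ c(-1)` otherwise. -/
def whittakerZ (ψ : LieAlgebra.LieCharacter ℂ positivePart) (ξ : ℂ) :
    UniversalEnvelopingAlgebra ℂ twistedNW :=
  if ψ amb1 = 0 then UniversalEnvelopingAlgebra.ι ℂ (apb 0 Even.zero)
  else ξ • UniversalEnvelopingAlgebra.ι ℂ (apb 0 Even.zero) -
    ψ amb1 • UniversalEnvelopingAlgebra.ι ℂ (cc (-1) (by decide))

end

/-! Write e(n) for (a+b)(n), n even, and (a-b)(n), n odd. Since ξ ≠ 0, the modes split into
Heisenberg pairs: c(m) with d(-m) and d(m) with c(-m), for odd m > 0, and e(m) with e(-m), for m >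
0. Each pair has a nonzero scalar commutator, up to a term c(0) = 0. Only e(0) is unpaired. The
bracket [d(1), e(0)] = e(1) acts on ω̄ as σ₁, and the correction by c(-1) cancels this, so z
commutes with the positive part up to terms vanishing on ℂ[z]ω̄.

Starting from ℂ[z]ω̄ (`zSpan`), adjoin the negative modes of c (`cSpan`), then of e (`eSpan`), then
of d (`dSpan`). Commuting operators past each other shows that the last space is stable under
everything, hence is the whole module (`dSpan_eq_top`). A Whittaker vector is then stripped of its
variables in reverse order: positive c-modes remove the d(-m), shifted e-modes remove the e(-m),
shifted d-modes remove the c(-m), and ℂ[z]ω̄ is left.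

Stripping off one variable is `mem_of_mem_extend`: if A kills W and [A, B] = r ≠ 0, then A has
kernel W on W + BW + B²W + ⋯. The sum is not assumed direct, so no PBW basis is needed, and the
argument applies to every module of level ξ generated by a vector of type ψ. -/

noncomputable section

open scoped TensorProduct
open NappiWitten AffineNW TwistedNW

/-! ### Adjoining variables to a subspace -/

namespace OperatorChain

open Module (End)

variable {V : Type*} [AddCommGroup V] [Module ℂ V]

/-- The subspace `W + B W + ⋯ + Bⁿ W`. -/
def extendUpTo (W : Submodule ℂ V) (B : End ℂ V) : ℕ → Submodule ℂ V
  | 0 => W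
  | n + 1 => W ⊔ (extendUpTo W B n).map B

/-- The smallest subspace that contains `W` and is stable under `B`. -/
def extend (W : Submodule ℂ V) (B : End ℂ V) : Submodule ℂ V := ⨆ n, extendUpTo W B n

variable {W Y : Submodule ℂ V} {B : End ℂ V}

theorem extendUpTo_mono : Monotone (extendUpTo W B) := by
  refine monotone_nat_of_le_succ fun n => ?_
  induction n with
  | zero => exact le_sup_left
  | succ n ih => exact sup_le_sup_left (Submodule.map_mono ih) W

theorem mem_extend {v : V} : v ∈ extend W B ↔ ∃ n, v ∈ extendUpTo W B n :=
  Submodule.mem_iSup_of_directed _ extendUpTo_mono.directed_le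

theorem mem_extendUpTo_succ {v : V} {n : ℕ} :
    v ∈ extendUpTo W B (n + 1) ↔ ∃ w ∈ W, ∃ u ∈ extendUpTo W B n, w + B u = v := by
  simp [extendUpTo, Submodule.mem_sup]

theorem le_extend : W ≤ extend W B := fun _ hw => mem_extend.2 ⟨0, hw⟩

theorem apply_mem_extend {v : V} (hv : v ∈ extend W B) : B v ∈ extend W B := by
  obtain ⟨n, hn⟩ := mem_extend.1 hv
  exact mem_extend.2 ⟨n + 1, mem_extendUpTo_succ.2 ⟨0, W.zero_mem, v, hn, zero_add _⟩⟩

theorem extend_induction {p : V → Prop} (h : ∀ w ∈ W, p w)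
    (hs : ∀ w ∈ W, ∀ u ∈ extend W B, p u → p (w + B u)) {v : V} (hv : v ∈ extend W B) : p v := by
  obtain ⟨n, hn⟩ := mem_extend.1 hv
  clear hv
  induction n generalizing v with
  | zero => exact h v hn
  | succ n ih =>
    obtain ⟨w, hw, u, hu, rfl⟩ := mem_extendUpTo_succ.1 hn
    exact hs w hw u (mem_extend.2 ⟨n, hu⟩) (ih hu)

/-- A family of operators maps `extend W B` into `Y` if it maps `W` into `Y` and its commutators
with `B` do not lead out of `Y`. -/
theorem map_extend {ι : Type*} (t : ι → End ℂ V) (hW : ∀ i, ∀ w ∈ W, t i w ∈ Y)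
    (hB : ∀ y ∈ Y, B y ∈ Y)
    (hc : ∀ i, ∀ u ∈ extend W B, (∀ k, t k u ∈ Y) → t i (B u) - B (t i u) ∈ Y) {v : V}
    (hv : v ∈ extend W B) (i : ι) : t i v ∈ Y := by
  refine extend_induction (p := fun v => ∀ i, t i v ∈ Y) (fun w hw i => hW i w hw)
    (fun w hw u hu ih i => ?_) hv i
  rw [map_add]
  refine Y.add_mem (hW i w hw) ?_
  have := Y.add_mem (hc i u hu ih) (hB _ (ih i))
  rwa [sub_add_cancel] at this

/-! ### Heisenberg pairs and the number operator -/

section Elimination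

variable {A : End ℂ V} {r : ℂ}

/-- On `Bⁱ W` the number operator `B A` acts as `i r`, so `B A + (k + 1) r` should have no kernel in
characteristic zero. As the sum of the `Bⁱ W` need not be direct, eigenvalues cannot be compared
summand by summand; induction on the degree in `B` replaces this. Stability under `B A` is carried
along so that the induction hypothesis also applies to `(B A + q) u`. -/
theorem eq_zero_of_number_add (hr : r ≠ 0) (hAB : ∀ v, A (B v) = B (A v) + r • v)
    (hA : ∀ w ∈ W, A w = 0) (n : ℕ) :
    ∀ v ∈ extendUpTo W B n, B (A v) ∈ extendUpTo W B n ∧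
      ∀ k : ℕ, B (A v) + ((k + 1) * r) • v = 0 → v = 0 := by
  have hk : ∀ k : ℕ, ((k : ℂ) + 1) * r ≠ 0 := fun k =>
    mul_ne_zero (by exact_mod_cast k.succ_ne_zero) hr
  induction n with
  | zero =>
    intro v hv
    rw [hA v hv, map_zero]
    exact ⟨Submodule.zero_mem _, fun k h => by simpa [hk k] using h⟩
  | succ n ih =>
    intro v hv
    obtain ⟨w, hw, u, hu, rfl⟩ := mem_extendUpTo_succ.1 hv
    have hBA : B (A (w + B u)) = B (B (A u) + r • u) := by
      rw [map_add A, hA w hw, zero_add, hAB]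
    have hmem : ∀ q : ℂ, B (A u) + q • u ∈ extendUpTo W B n := fun q =>
      Submodule.add_mem _ (ih u hu).1 (Submodule.smul_mem _ _ hu)
    refine ⟨?_, fun k h => ?_⟩
    · rw [hBA]
      exact mem_extendUpTo_succ.2 ⟨0, W.zero_mem, _, hmem r, zero_add _⟩
    · have h' : ((k + 1) * r) • w + B (B (A u) + (((k + 1 : ℕ) + 1) * r) • u) = 0 := by
        rw [← h, hBA]
        simp only [map_add, map_smul]
        push_cast
        module
      -- Let `u'` be the left side. Applying `A` to `h'` kills the `w`-term and leaves `(B A + r) u'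
      -- = 0`, the case `k = 0` for `u'`. Then `u' = 0` is the case `k + 1` for `u`.
      have h1 : B (A u) + (((k + 1 : ℕ) + 1) * r) • u = 0 := by
        refine (ih _ (hmem _)).2 0 ?_
        have := congrArg A h'
        rw [map_add, map_smul, hA w hw, smul_zero, zero_add, hAB, map_zero] at this
        simpa using this
      have hu0 : u = 0 := (ih u hu).2 _ h1
      subst hu0
      simp only [map_zero, smul_zero, add_zero] at h' ⊢
      exact (smul_eq_zero.1 h').resolve_left (hk k)

/-- If `A` vanishes on `W` and `[A, B]` is a nonzero scalar, then the kernel of `A` in `extend W B`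
is `W`. -/
theorem mem_of_mem_extend (hr : r ≠ 0) (hAB : ∀ v, A (B v) = B (A v) + r • v)
    (hA : ∀ w ∈ W, A w = 0) {v : V} (hv : v ∈ extend W B) (h : A v = 0) : v ∈ W := by
  obtain ⟨n, hn⟩ := mem_extend.1 hv
  cases n with
  | zero => exact hn
  | succ n =>
    obtain ⟨w, hw, u, hu, rfl⟩ := mem_extendUpTo_succ.1 hn
    rw [map_add, hA w hw, zero_add, hAB] at h
    have hu0 : u = 0 := (eq_zero_of_number_add hr hAB hA n u hu).2 0 (by simpa using h)
    rw [hu0, map_zero, add_zero]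
    exact hw

end Elimination

/-! ### Adjoining a sequence of operators -/

/-- The subspaces obtained from `W` by adjoining `B 0`, `B 1`, … one after the other. -/
def chain (W : Submodule ℂ V) (B : ℕ → End ℂ V) : ℕ → Submodule ℂ V
  | 0 => W
  | j + 1 => extend (chain W B j) (B j)

/-- The union of the subspaces `chain W B j`. -/
def chainSup (W : Submodule ℂ V) (B : ℕ → End ℂ V) : Submodule ℂ V := ⨆ j, chain W B j

variable {B : ℕ → End ℂ V}

theorem chain_mono : Monotone (chain W B) := monotone_nat_of_le_succ fun _ => le_extend

theorem mem_chainSup {v : V} : v ∈ chainSup W B ↔ ∃ j, v ∈ chain W B j :=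
  Submodule.mem_iSup_of_directed _ chain_mono.directed_le

theorem le_chainSup : W ≤ chainSup W B := fun _ hw => mem_chainSup.2 ⟨0, hw⟩

/-- With `Y = ⊥` this is a criterion for annihilation, with larger `Y` one for stability. Only
commutators with the `B k`, `k < j`, enter, so `t` may fail to commute with operators adjoined
later. A family `t` is allowed because a commutator may involve other members of the family. -/
theorem map_chain {ι : Type*} (t : ι → End ℂ V) (j : ℕ) (hW : ∀ i, ∀ w ∈ W, t i w ∈ Y)
    (hB : ∀ k < j, ∀ y ∈ Y, B k y ∈ Y)
    (hc : ∀ k < j, ∀ i, ∀ u ∈ chain W B j, (∀ l, t l u ∈ Y) →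
      t i (B k u) - B k (t i u) ∈ Y) {v : V} (hv : v ∈ chain W B j) (i : ι) : t i v ∈ Y := by
  induction j generalizing v i with
  | zero => exact hW i v hv
  | succ j ih =>
    refine map_extend t (fun i w hw => ih (fun k hk => hB k (by omega)) (fun k hk i u hu => ?_) hw i)
      (hB j (by omega)) (fun i u hu => hc j (by omega) i u hu) hv i
    exact hc k (by omega) i u (chain_mono (Nat.le_succ j) hu)

theorem map_chainSup {ι : Type*} (t : ι → End ℂ V) (hW : ∀ i, ∀ w ∈ W, t i w ∈ Y)
    (hB : ∀ k, ∀ y ∈ Y, B k y ∈ Y)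
    (hc : ∀ k i, ∀ u ∈ chainSup W B, (∀ l, t l u ∈ Y) → t i (B k u) - B k (t i u) ∈ Y) {v : V}
    (hv : v ∈ chainSup W B) (i : ι) : t i v ∈ Y := by
  obtain ⟨j, hj⟩ := mem_chainSup.1 hv
  exact map_chain t j hW (fun k _ => hB k) (fun k _ i u hu => hc k i u (mem_chainSup.2 ⟨j, hu⟩)) hj i

theorem map_chain_of_commute {t : End ℂ V} (hW : ∀ w ∈ W, t w ∈ W)
    (hc : ∀ k v, t (B k v) = B k (t v)) (j : ℕ) {v : V} (hv : v ∈ chain W B j) :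
    t v ∈ chain W B j := by
  induction j generalizing v with
  | zero => exact hW v hv
  | succ j ih =>
    refine map_extend (fun _ : Unit => t) (fun _ w hw => le_extend (ih hw))
      (fun y hy => apply_mem_extend hy) (fun _ u _ _ => ?_) hv ()
    rw [hc, sub_self]
    exact Submodule.zero_mem _

theorem map_chainSup_of_commute {t : End ℂ V} (hW : ∀ w ∈ W, t w ∈ W)
    (hc : ∀ k v, t (B k v) = B k (t v)) {v : V} (hv : v ∈ chainSup W B) : t v ∈ chainSup W B := by
  obtain ⟨j, hj⟩ := mem_chainSup.1 hv
  exact mem_chainSup.2 ⟨j, map_chain_of_commute hW hc j hj⟩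

/-- The subspace `chainSup W B` is stable under each `B i` if the commutators of the `B i` preserve
the steps of the chain. -/
theorem apply_mem_chainSup (hc : ∀ i k j, ∀ u ∈ chain W B j,
    B i (B k u) - B k (B i u) ∈ chain W B j) (i : ℕ) {v : V} (hv : v ∈ chainSup W B) :
    B i v ∈ chainSup W B := by
  -- Step `i + 1` is stable under `B i` by construction; the commutators carry this past the
  -- operators adjoined later.
  have key : ∀ j, i < j → ∀ v ∈ chain W B j, B i v ∈ chain W B j := by
    intro j hij
    induction j, hij using Nat.le_induction with
    | base => exact fun v hv => apply_mem_extend hv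
    | succ j _ ih =>
      exact fun v hv => map_extend (fun _ : Unit => B i) (fun _ w hw => le_extend (ih w hw))
        (fun y hy => apply_mem_extend hy) (fun _ u hu _ => hc i j (j + 1) u hu) hv ()
  obtain ⟨j, hj⟩ := mem_chainSup.1 hv
  exact mem_chainSup.2 ⟨max j (i + 1), key _ (by omega) v (chain_mono (le_max_left _ _) hj)⟩

/-- The vectors of `chainSup W B` annihilated by all `A j` lie in `W`, if `A j` vanishes on the
`j`-th step of the chain and `[A j, B j]` is a nonzero scalar. -/
theorem mem_of_mem_chainSup {A : ℕ → End ℂ V} {r : ℕ → ℂ} (hr : ∀ j, r j ≠ 0)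
    (hAB : ∀ j v, A j (B j v) = B j (A j v) + r j • v)
    (hA : ∀ j, ∀ w ∈ chain W B j, A j w = 0) {v : V} (hv : v ∈ chainSup W B)
    (h : ∀ j, A j v = 0) : v ∈ W := by
  obtain ⟨j, hj⟩ := mem_chainSup.1 hv
  clear hv
  induction j with
  | zero => exact hj
  | succ j ih => exact ih (mem_of_mem_extend (hr j) (hAB j) (hA j) hj (h j))

end OperatorChain

/-! ### Whittaker vectors in cyclic modules -/

open OperatorChain

/-- A module of level `ξ` over the twisted affine Nappi-Witten algebra which is generated by a
Whittaker vector `ω` on which the positive modes of `c` vanish, in terms of operators: `e n` is the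
action of `(a+b)(n)` for even `n` and of `(a-b)(n)` for odd `n`; the operator `c n` is zero for even
`n`; only the operators `d n` with `n` odd matter. -/
structure CyclicWhittakerModule (V : Type*) [AddCommGroup V] [Module ℂ V] where
  e : ℤ → Module.End ℂ V
  c : ℤ → Module.End ℂ V
  d : ℤ → Module.End ℂ V
  ω : V
  ξ : ℂ
  σ : ℂ
  χ : ℤ → ℂ
  ξ_ne_zero : ξ ≠ 0
  c_even : ∀ n, Even n → c n = 0
  e_e : ∀ m n v, e m (e n v) = e n (e m v) + (-2 * (-1 : ℂ) ^ m) • c (m + n) v +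
    (if m + n = 0 then 2 * m * (-1 : ℂ) ^ m * ξ else 0) • v
  c_e : ∀ m n v, c m (e n v) = e n (c m v)
  c_c : ∀ m n v, c m (c n v) = c n (c m v)
  d_d : ∀ m n v, Odd m → Odd n → d m (d n v) = d n (d m v)
  d_e : ∀ m n v, Odd m → d m (e n v) = e n (d m v) + e (m + n) v
  c_d : ∀ m n v, Odd n → c m (d n v) = d n (c m v) + (if m + n = 0 then m * ξ else 0) • v
  e_ω : ∀ m, 0 < m → e m ω = (if m = 1 then σ else 0) • ω
  c_ω : ∀ m, 0 < m → c m ω = 0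
  d_ω : ∀ m, Odd m → 0 < m → d m ω = χ m • ω
  cyclic : ∀ W : Submodule ℂ V, ω ∈ W → (∀ n, ∀ w ∈ W, e n w ∈ W) → (∀ n, ∀ w ∈ W, c n w ∈ W) →
    (∀ n, Odd n → ∀ w ∈ W, d n w ∈ W) → W = ⊤

namespace CyclicWhittakerModule

variable {V : Type*} [AddCommGroup V] [Module ℂ V] (S : CyclicWhittakerModule V)

/-- The operator `α e(0) - β c(-1)`. -/
def zOp (α β : ℂ) : Module.End ℂ V := α • S.e 0 - β • S.c (-1)

theorem zOp_apply (α β : ℂ) (v : V) : S.zOp α β v = α • S.e 0 v - β • S.c (-1) v := rfl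

/-- The span of the vectors `zᵏ ω` for `z = α e(0) - β c(-1)`. -/
def zSpan (α β : ℂ) : Submodule ℂ V := extend (Submodule.span ℂ {S.ω}) (S.zOp α β)

/-- The operators `c(-1), c(-3), …`. -/
def cNeg (j : ℕ) : Module.End ℂ V := S.c (-(2 * j + 1))
/-- The operators `e(-1), e(-2), …`. -/
def eNeg (j : ℕ) : Module.End ℂ V := S.e (-(j + 1))
/-- The operators `d(-1), d(-3), …`. -/
def dNeg (j : ℕ) : Module.End ℂ V := S.d (-(2 * j + 1))

/-- The subspace generated from `ω` by `z` and the negative modes of `c`. -/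
def cSpan (α β : ℂ) : Submodule ℂ V := chainSup (S.zSpan α β) S.cNeg

/-- The subspace generated from `ω` by the modes of `c` and `e`. -/
def eSpan (α β : ℂ) : Submodule ℂ V := chainSup (S.cSpan α β) S.eNeg

/-- The subspace generated from `ω` by the modes of `c`, `e` and `d`. -/
def dSpan (α β : ℂ) : Submodule ℂ V := chainSup (S.eSpan α β) S.dNeg

/-- The operator `e(m) - ψ(e(m))`. -/
def eShift (m : ℤ) : Module.End ℂ V := S.e m - (if m = 1 then S.σ else 0) • 1
/-- The operator `d(m) - ψ(d(m))`. -/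
def dShift (m : ℤ) : Module.End ℂ V := S.d m - S.χ m • 1

theorem eShift_apply (m : ℤ) (v : V) :
    S.eShift m v = S.e m v - (if m = 1 then S.σ else 0) • v := rfl
theorem dShift_apply (m : ℤ) (v : V) : S.dShift m v = S.d m v - S.χ m • v := rfl

theorem d_c (m n : ℤ) (v : V) (hm : Odd m) :
    S.d m (S.c n v) = S.c n (S.d m v) - (if m + n = 0 then n * S.ξ else 0) • v := by
  rw [S.c_d n m v hm, add_comm n m, add_sub_cancel_right]

theorem odd_neg_two_mul_add_one (j : ℕ) : Odd (-(2 * (j : ℤ) + 1)) := ⟨-j - 1, by ring⟩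

variable {S} {α β : ℂ}

/-! ### Subspaces killed by the shifted positive modes -/

section Annihilation

theorem zSpan_annihilated {t : Module.End ℂ V} (hω : t S.ω = 0)
    (hc : ∀ u ∈ S.zSpan α β, t u = 0 → t (S.zOp α β u) = S.zOp α β (t u)) {v : V}
    (hv : v ∈ S.zSpan α β) : t v = 0 := by
  refine map_extend (Y := ⊥) (fun _ : Unit => t) (fun _ w hw => ?_) (fun y hy => ?_)
    (fun _ u hu h => ?_) hv ()
  · obtain ⟨r, rfl⟩ := Submodule.mem_span_singleton.1 hw
    simp [hω]
  · simp [(Submodule.mem_bot ℂ).1 hy]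
  · rw [hc u hu (h ()), sub_self]
    exact Submodule.zero_mem _

theorem chain_annihilated {W : Submodule ℂ V} {B : ℕ → Module.End ℂ V} {t : Module.End ℂ V} {j : ℕ}
    (hW : ∀ w ∈ W, t w = 0) (hc : ∀ k < j, ∀ u ∈ chain W B j, t (B k u) = B k (t u)) {v : V}
    (hv : v ∈ chain W B j) : t v = 0 := by
  refine map_chain (Y := ⊥) (fun _ : Unit => t) j (fun _ w hw => hW w hw) (fun k _ y hy => ?_)
    (fun k hk _ u hu _ => ?_) hv ()
  · simp [(Submodule.mem_bot ℂ).1 hy]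
  · rw [hc k hk u hu, sub_self]
    exact Submodule.zero_mem _

theorem chainSup_annihilated {W : Submodule ℂ V} {B : ℕ → Module.End ℂ V} {t : Module.End ℂ V}
    (hW : ∀ w ∈ W, t w = 0) (hc : ∀ k u, t (B k u) = B k (t u)) {v : V}
    (hv : v ∈ chainSup W B) : t v = 0 := by
  obtain ⟨j, hj⟩ := mem_chainSup.1 hv
  exact chain_annihilated hW (fun k _ u _ => hc k u) hj

theorem c_zOp (m : ℤ) (v : V) : S.c m (S.zOp α β v) = S.zOp α β (S.c m v) := by
  simp only [zOp_apply, map_sub, map_smul, S.c_e, S.c_c m (-1)]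

theorem c_zSpan {m : ℤ} (hm : 0 < m) {v : V} (hv : v ∈ S.zSpan α β) : S.c m v = 0 :=
  zSpan_annihilated (S.c_ω m hm) (fun u _ _ => c_zOp m u) hv

theorem c_cSpan {m : ℤ} (hm : 0 < m) {v : V} (hv : v ∈ S.cSpan α β) : S.c m v = 0 :=
  chainSup_annihilated (fun _ hw => c_zSpan hm hw) (fun _ u => S.c_c m _ u) hv

theorem c_eSpan {m : ℤ} (hm : 0 < m) {v : V} (hv : v ∈ S.eSpan α β) : S.c m v = 0 :=
  chainSup_annihilated (fun _ hw => c_cSpan hm hw) (fun _ u => S.c_e m _ u) hv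

theorem eShift_c (m n : ℤ) (v : V) : S.eShift m (S.c n v) = S.c n (S.eShift m v) := by
  simp only [eShift_apply, map_sub, map_smul, S.c_e]

theorem eShift_e {m n : ℤ} (h : m + n ≠ 0) (v : V) :
    S.eShift m (S.e n v) = S.e n (S.eShift m v) + (-2 * (-1 : ℂ) ^ m) • S.c (m + n) v := by
  rw [eShift_apply, eShift_apply, S.e_e, if_neg h, map_sub, map_smul]
  module

theorem eShift_zSpan {m : ℤ} (hm : 0 < m) {v : V} (hv : v ∈ S.zSpan α β) : S.eShift m v = 0 := by
  refine zSpan_annihilated ?_ (fun u hu _ => ?_) hv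
  · rw [eShift_apply, S.e_ω m hm, sub_self]
  · rw [zOp_apply, zOp_apply, map_sub, map_smul, map_smul, eShift_c, eShift_e (by omega), add_zero,
      c_zSpan hm hu, smul_zero, add_zero]

theorem eShift_cSpan {m : ℤ} (hm : 0 < m) {v : V} (hv : v ∈ S.cSpan α β) : S.eShift m v = 0 :=
  chainSup_annihilated (fun _ hw => eShift_zSpan hm hw) (fun _ u => eShift_c m _ u) hv

/-- For `k < j < m` the bracket of e(m) with e(-k-1) is a multiple of c(m-k-1), whose mode is
positive and therefore kills `eSpan`. Modes adjoined at later steps could give negative c-modes or a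
central term. -/
theorem eShift_chain {m : ℤ} {j : ℕ} (hm : j < m) {v : V}
    (hv : v ∈ chain (S.cSpan α β) S.eNeg j) : S.eShift m v = 0 := by
  refine chain_annihilated (fun w hw => eShift_cSpan (by omega) hw) (fun k hk u hu => ?_) hv
  rw [eNeg, eShift_e (by omega), c_eSpan (by omega) (mem_chainSup.2 ⟨j, hu⟩), smul_zero, add_zero]

/-- The bracket of d(m) with z is α e(m), minus βξ if m = 1. On `zSpan` e(m) acts as σ for m = 1 and
as 0 for m > 1, so the bracket vanishes there exactly because of `hαβ`. -/
theorem dShift_zSpan (hαβ : α * S.σ = β * S.ξ) {m : ℤ} (hm : Odd m) (hpos : 0 < m) {v : V}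
    (hv : v ∈ S.zSpan α β) : S.dShift m v = 0 := by
  refine zSpan_annihilated ?_ (fun u hu _ => ?_) hv
  · rw [dShift_apply, S.d_ω m hm hpos, sub_self]
  · have h := eShift_zSpan hpos hu
    rw [eShift_apply, sub_eq_zero] at h
    simp only [dShift_apply, zOp_apply, map_sub, map_smul, S.d_e m 0 u hm, S.d_c m (-1) u hm,
      add_zero, h]
    by_cases h1 : m = 1
    · subst h1
      simp only [if_true, add_neg_cancel, Int.cast_neg, Int.cast_one]
      linear_combination (norm := module) hαβ • u
    · rw [if_neg h1, if_neg (by omega)]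
      module

theorem dShift_c {m n : ℤ} (hm : Odd m) (h : m + n ≠ 0) (v : V) :
    S.dShift m (S.c n v) = S.c n (S.dShift m v) := by
  simp only [dShift_apply, map_sub, map_smul, S.d_c m n v hm, if_neg h, zero_smul, sub_zero]

theorem dShift_chain (hαβ : α * S.σ = β * S.ξ) {m : ℤ} (hm : Odd m) {j : ℕ} (hj : 2 * (j : ℤ) < m)
    {v : V} (hv : v ∈ chain (S.zSpan α β) S.cNeg j) : S.dShift m v = 0 :=
  chain_annihilated (fun _ hw => dShift_zSpan hαβ hm (by omega) hw)
    (fun k hk u _ => dShift_c hm (by omega) u) hv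

theorem c_chain {m : ℤ} {j : ℕ} (hj : 2 * (j : ℤ) < m)
    {v : V} (hv : v ∈ chain (S.eSpan α β) S.dNeg j) : S.c m v = 0 := by
  refine chain_annihilated (fun _ hw => c_eSpan (by omega) hw) (fun k hk u _ => ?_) hv
  rw [dNeg, S.c_d _ _ _ (odd_neg_two_mul_add_one k), if_neg (by omega), zero_smul, add_zero]

end Annihilation

/-! ### Stability under all modes -/

section Stability

theorem zOp_zSpan {v : V} (hv : v ∈ S.zSpan α β) : S.zOp α β v ∈ S.zSpan α β :=
  apply_mem_extend hv

theorem zOp_cSpan {v : V} (hv : v ∈ S.cSpan α β) : S.zOp α β v ∈ S.cSpan α β :=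
  map_chainSup_of_commute (fun _ => zOp_zSpan) (fun _ u => (c_zOp _ u).symm) hv

theorem cNeg_cSpan (i : ℕ) {v : V} (hv : v ∈ S.cSpan α β) : S.cNeg i v ∈ S.cSpan α β := by
  refine apply_mem_chainSup (fun i k j u _ => ?_) i hv
  rw [cNeg, cNeg, S.c_c, sub_self]
  exact Submodule.zero_mem _

theorem c_mem_cSpan (m : ℤ) {v : V} (hv : v ∈ S.cSpan α β) : S.c m v ∈ S.cSpan α β := by
  rcases Int.even_or_odd m with hm | ⟨k, hk⟩
  · simp [S.c_even m hm]
  · rcases lt_or_ge 0 m with hpos | hneg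
    · rw [c_cSpan hpos hv]
      exact Submodule.zero_mem _
    · have : S.c m = S.cNeg (-k - 1).toNat := by
        rw [cNeg]
        congr 1
        omega
      rw [this]
      exact cNeg_cSpan _ hv

theorem e_mem_cSpan (hα : α ≠ 0) {m : ℤ} (hm : 0 ≤ m) {v : V} (hv : v ∈ S.cSpan α β) :
    S.e m v ∈ S.cSpan α β := by
  rcases hm.eq_or_lt with rfl | hpos
  -- As α ≠ 0, e(0) is recovered from z and c(-1).
  · have : S.e 0 v = α⁻¹ • (S.zOp α β v + β • S.c (-1) v) := by
      rw [zOp_apply, sub_add_cancel, smul_smul, inv_mul_cancel₀ hα, one_smul]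
    rw [this]
    exact Submodule.smul_mem _ _
      (Submodule.add_mem _ (zOp_cSpan hv) (Submodule.smul_mem _ _ (c_mem_cSpan _ hv)))
  · rw [sub_eq_zero.1 ((S.eShift_apply m v).symm.trans (eShift_cSpan hpos hv))]
    exact Submodule.smul_mem _ _ hv

theorem d_mem_cSpan (hαβ : α * S.σ = β * S.ξ) {m : ℤ} (hm : Odd m) (hpos : 0 < m) {v : V}
    (hv : v ∈ S.cSpan α β) : S.d m v ∈ S.cSpan α β := by
  refine map_chainSup (fun _ : Unit => S.d m) (fun _ w hw => le_chainSup ?_)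
    (fun k y hy => cNeg_cSpan k hy) (fun k _ u hu _ => ?_) hv ()
  · rw [sub_eq_zero.1 ((S.dShift_apply m w).symm.trans (dShift_zSpan hαβ hm hpos hw))]
    exact Submodule.smul_mem _ _ hw
  · rw [cNeg, S.d_c _ _ _ hm, sub_sub_cancel_left]
    exact Submodule.neg_mem _ (Submodule.smul_mem _ _ hu)

theorem c_mem_eSpan (m : ℤ) {v : V} (hv : v ∈ S.eSpan α β) : S.c m v ∈ S.eSpan α β :=
  map_chainSup_of_commute (fun _ hw => c_mem_cSpan m hw) (fun _ u => S.c_e _ _ u) hv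

theorem eNeg_eSpan (i : ℕ) {v : V} (hv : v ∈ S.eSpan α β) : S.eNeg i v ∈ S.eSpan α β := by
  refine apply_mem_chainSup (fun i k j u hu => ?_) i hv
  rw [eNeg, eNeg, S.e_e, if_neg (by omega), zero_smul, add_zero, add_sub_cancel_left]
  exact Submodule.smul_mem _ _
    (map_chain_of_commute (fun _ hw => c_mem_cSpan _ hw) (fun _ u => S.c_e _ _ u) j hu)

theorem e_mem_eSpan (hα : α ≠ 0) (m : ℤ) {v : V} (hv : v ∈ S.eSpan α β) :
    S.e m v ∈ S.eSpan α β := by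
  rcases le_or_gt 0 m with hm | hm
  · refine map_chainSup (fun _ : Unit => S.e m) (fun _ w hw => le_chainSup (e_mem_cSpan hα hm hw))
      (fun k y hy => eNeg_eSpan k hy) (fun k _ u hu _ => ?_) hv ()
    rw [eNeg, S.e_e, add_assoc, add_sub_cancel_left]
    exact Submodule.add_mem _ (Submodule.smul_mem _ _ (c_mem_eSpan _ hu))
      (Submodule.smul_mem _ _ hu)
  · have : S.e m = S.eNeg (-m - 1).toNat := by
      rw [eNeg]
      congr 1
      omega
    rw [this]
    exact eNeg_eSpan _ hv

theorem d_mem_eSpan (hα : α ≠ 0) (hαβ : α * S.σ = β * S.ξ) {m : ℤ} (hm : Odd m) (hpos : 0 < m)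
    {v : V} (hv : v ∈ S.eSpan α β) : S.d m v ∈ S.eSpan α β := by
  refine map_chainSup (fun _ : Unit => S.d m)
    (fun _ w hw => le_chainSup (d_mem_cSpan hαβ hm hpos hw))
    (fun k y hy => eNeg_eSpan k hy) (fun k _ u hu _ => ?_) hv ()
  rw [eNeg, S.d_e _ _ _ hm, add_sub_cancel_left]
  exact e_mem_eSpan hα _ hu

theorem dNeg_dSpan (i : ℕ) {v : V} (hv : v ∈ S.dSpan α β) : S.dNeg i v ∈ S.dSpan α β := by
  refine apply_mem_chainSup (fun i k j u _ => ?_) i hv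
  rw [dNeg, dNeg, S.d_d _ _ _ (odd_neg_two_mul_add_one i) (odd_neg_two_mul_add_one k), sub_self]
  exact Submodule.zero_mem _

theorem d_mem_dSpan (hα : α ≠ 0) (hαβ : α * S.σ = β * S.ξ) {m : ℤ} (hm : Odd m) {v : V}
    (hv : v ∈ S.dSpan α β) : S.d m v ∈ S.dSpan α β := by
  rcases lt_or_ge 0 m with hpos | hneg
  · exact map_chainSup_of_commute (fun _ hw => d_mem_eSpan hα hαβ hm hpos hw)
      (fun k u => S.d_d _ _ _ hm (odd_neg_two_mul_add_one k)) hv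
  · obtain ⟨k, hk⟩ := hm
    have : S.d m = S.dNeg (-k - 1).toNat := by
      rw [dNeg]
      congr 1
      omega
    rw [this]
    exact dNeg_dSpan _ hv

theorem c_mem_dSpan (m : ℤ) {v : V} (hv : v ∈ S.dSpan α β) : S.c m v ∈ S.dSpan α β := by
  refine map_chainSup (fun _ : Unit => S.c m) (fun _ w hw => le_chainSup (c_mem_eSpan m hw))
    (fun k y hy => dNeg_dSpan k hy) (fun k _ u hu _ => ?_) hv ()
  rw [dNeg, S.c_d _ _ _ (odd_neg_two_mul_add_one k), add_sub_cancel_left]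
  exact Submodule.smul_mem _ _ hu

/-- Commuting e(i) past a negative d-mode produces another mode of e, so all the e(i) have to be
treated simultaneously. -/
theorem e_mem_dSpan (hα : α ≠ 0) (m : ℤ) {v : V} (hv : v ∈ S.dSpan α β) :
    S.e m v ∈ S.dSpan α β := by
  refine map_chainSup S.e (fun i w hw => le_chainSup (e_mem_eSpan hα i hw))
    (fun k y hy => dNeg_dSpan k hy) (fun k i u hu h => ?_) hv m
  rw [dNeg, S.d_e _ _ _ (odd_neg_two_mul_add_one k), sub_add_cancel_left]
  exact Submodule.neg_mem _ (h _)

theorem dSpan_eq_top (hα : α ≠ 0) (hαβ : α * S.σ = β * S.ξ) : S.dSpan α β = ⊤ :=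
  S.cyclic _
    (le_chainSup (le_chainSup (le_chainSup (le_extend (Submodule.mem_span_singleton_self _)))))
    (fun n _ hw => e_mem_dSpan hα n hw) (fun n _ hw => c_mem_dSpan n hw)
    (fun _ hn _ hw => d_mem_dSpan hα hαβ hn hw)

end Stability

/-! ### Stripping the variables off a Whittaker vector -/

theorem mem_eSpan (hα : α ≠ 0) (hαβ : α * S.σ = β * S.ξ) {v : V}
    (hc : ∀ m, Odd m → 0 < m → S.c m v = 0) : v ∈ S.eSpan α β := by
  have hv : v ∈ S.dSpan α β := by
    rw [dSpan_eq_top hα hαβ]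
    exact Submodule.mem_top
  refine mem_of_mem_chainSup (A := fun j => S.c (2 * j + 1)) (r := fun j => (2 * j + 1) * S.ξ)
    (fun j => mul_ne_zero (by exact_mod_cast (2 * j).succ_ne_zero) S.ξ_ne_zero) (fun j w => ?_)
    (fun j w hw => c_chain (by omega) hw) hv (fun j => hc _ ⟨j, rfl⟩ (by omega))
  rw [dNeg, S.c_d _ _ _ (odd_neg_two_mul_add_one j), if_pos (by omega)]
  push_cast
  rfl

theorem mem_cSpan {v : V} (hv : v ∈ S.eSpan α β) (he : ∀ m, 0 < m → S.eShift m v = 0) :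
    v ∈ S.cSpan α β := by
  refine mem_of_mem_chainSup (A := fun j => S.eShift (j + 1))
    (r := fun j => 2 * (j + 1) * (-1 : ℂ) ^ ((j : ℤ) + 1) * S.ξ)
    (fun j => mul_ne_zero (mul_ne_zero (mul_ne_zero two_ne_zero (by exact_mod_cast j.succ_ne_zero))
      (zpow_ne_zero _ (by norm_num))) S.ξ_ne_zero) (fun j w => ?_)
    (fun j w hw => eShift_chain (by omega) hw) hv (fun j => he _ (by omega))
  -- The c-term of [e(j+1), e(-j-1)] is c(0) = 0, so the commutator is a scalar.
  rw [eNeg, eShift_apply, eShift_apply, S.e_e, if_pos (by omega), S.c_even _ (by simp), map_sub,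
    map_smul, LinearMap.zero_apply]
  push_cast
  module

theorem mem_zSpan (hαβ : α * S.σ = β * S.ξ) {v : V} (hv : v ∈ S.cSpan α β)
    (hd : ∀ m, Odd m → 0 < m → S.dShift m v = 0) : v ∈ S.zSpan α β := by
  refine mem_of_mem_chainSup (A := fun j => S.dShift (2 * j + 1))
    (r := fun j => (2 * j + 1) * S.ξ)
    (fun j => mul_ne_zero (by exact_mod_cast (2 * j).succ_ne_zero) S.ξ_ne_zero) (fun j w => ?_)
    (fun j w hw => dShift_chain hαβ ⟨j, rfl⟩ (by omega) hw) hv (fun j => hd _ ⟨j, rfl⟩ (by omega))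
  rw [cNeg, dShift_apply, dShift_apply, S.d_c _ _ _ ⟨j, rfl⟩, if_pos (by omega), map_sub, map_smul]
  push_cast
  module

/-- The Whittaker vectors of the type of `ω` are the nonzero vectors of `zSpan`. -/
theorem mem_zSpan_iff (hα : α ≠ 0) (hαβ : α * S.σ = β * S.ξ) {v : V} :
    v ∈ S.zSpan α β ↔ ∀ m : ℤ, 0 < m → S.eShift m v = 0 ∧ S.c m v = 0 ∧
      (Odd m → S.dShift m v = 0) :=
  ⟨fun hv _ hm => ⟨eShift_zSpan hm hv, c_zSpan hm hv, fun ho => dShift_zSpan hαβ ho hm hv⟩,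
    fun h => mem_zSpan hαβ (mem_cSpan (mem_eSpan hα hαβ fun m _ hm => (h m hm).2.1)
      fun m hm => (h m hm).1) fun m ho hm => (h m hm).2.2 ho⟩

end CyclicWhittakerModule

/-! ### The modes of the twisted affine Nappi-Witten algebra -/

namespace TwistedNW

/-- The projection of `H₄` onto the eigenspace of `τ` for the eigenvalue `(-1)ⁿ`. -/
def tauProj (n : ℤ) : NappiWitten →ₗ[ℂ] NappiWitten :=
  (1 / 2 : ℂ) • (LinearMap.id + (-1 : ℂ) ^ n • (tau : NappiWitten →ₗ[ℂ] NappiWitten))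

theorem tauProj_apply (n : ℤ) (x : NappiWitten) :
    tauProj n x = (1 / 2 : ℂ) • (x + (-1 : ℂ) ^ n • tau x) := rfl

theorem neg_one_zpow_mul_self (n : ℤ) : (-1 : ℂ) ^ n * (-1 : ℂ) ^ n = 1 := by
  rw [← mul_zpow]; simp

theorem tau_tau (x : NappiWitten) : tau (tau x) = x := by
  ext <;> simp [tau_apply]

theorem tau_tauProj (n : ℤ) (x : NappiWitten) : tau (tauProj n x) = (-1 : ℂ) ^ n • tauProj n x := by
  rw [tauProj_apply, map_smul, map_add, map_smul, tau_tau, smul_comm ((-1 : ℂ) ^ n) (1 / 2 : ℂ),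
    smul_add ((-1 : ℂ) ^ n), smul_smul ((-1 : ℂ) ^ n), neg_one_zpow_mul_self, one_smul, add_comm]

theorem tauProj_zero (n : ℤ) (x : NappiWitten) :
    tauProj n x 0 = (1 / 2) * (x 0 + (-1) ^ n * x 1) := by simp [tauProj_apply, tau_apply]
theorem tauProj_one (n : ℤ) (x : NappiWitten) :
    tauProj n x 1 = (1 / 2) * (x 1 + (-1) ^ n * x 0) := by simp [tauProj_apply, tau_apply]
theorem tauProj_two (n : ℤ) (x : NappiWitten) :
    tauProj n x 2 = (1 / 2) * (x 2 - (-1) ^ n * x 2) := by simp [tauProj_apply, tau_apply]; ring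
theorem tauProj_three (n : ℤ) (x : NappiWitten) :
    tauProj n x 3 = (1 / 2) * (x 3 - (-1) ^ n * x 3) := by simp [tauProj_apply, tau_apply]; ring

/-- The projection of `x(n)` to the fixed points of `τ̂`. -/
def mode (n : ℤ) (x : NappiWitten) : twistedNW :=
  ⟨loop (tauProj n x) n, loop_mem _ _ (tau_tauProj n x)⟩

theorem mode_add (n : ℤ) (x y : NappiWitten) : mode n (x + y) = mode n x + mode n y :=
  Subtype.ext (by simp [mode, loop_add])

theorem mode_smul (n : ℤ) (r : ℂ) (x : NappiWitten) : mode n (r • x) = r • mode n x :=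
  Subtype.ext (by simp [mode, loop_smul])

theorem mode_congr {n : ℤ} {x y : NappiWitten} (h : tauProj n x = tauProj n y) :
    mode n x = mode n y := Subtype.ext (congrArg (loop · n) h)

theorem mode_zero (n : ℤ) : mode n 0 = 0 := by
  simpa using mode_smul n 0 0

theorem lie_mode_mode {m n : ℤ} {x y z : NappiWitten}
    (h : tauProj (m + n) z = ⁅tauProj m x, tauProj n y⁆) :
    ⁅mode m x, mode n y⁆ = mode (m + n) z +
      (if m + n = 0 then (m : ℂ) * form (tauProj m x) (tauProj n y) else 0) • kk := by
  apply Subtype.ext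
  change ⁅loop (tauProj m x) m, loop (tauProj n y) n⁆ = loop (tauProj (m + n) z) (m + n) + _ • central
  rw [lie_loop_loop, h]

theorem mode_mem_positivePart {n : ℤ} (x : NappiWitten) (hn : 0 < n) : mode n x ∈ positivePart :=
  loop_mem_span _ _ (tau_tauProj n x) hn

/-- The single vector 2a serves both parities: its projection is a + b for even modes and a - b for
odd ones. -/
theorem apb_eq_mode (n : ℤ) (hn : Even n) : apb n hn = mode n ((2 : ℂ) • a) := by
  apply Subtype.ext
  refine congrArg (loop · n) ?_
  ext <;> simp [tauProj_zero, tauProj_one, tauProj_two, tauProj_three, hn.neg_one_zpow, a, b]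

theorem amb_eq_mode (n : ℤ) (hn : Odd n) : amb n hn = mode n ((2 : ℂ) • a) := by
  apply Subtype.ext
  refine congrArg (loop · n) ?_
  ext <;> simp [tauProj_zero, tauProj_one, tauProj_two, tauProj_three, hn.neg_one_zpow, a, b]

theorem cc_eq_mode (n : ℤ) (hn : Odd n) : cc n hn = mode n c := by
  apply Subtype.ext
  refine congrArg (loop · n) ?_
  ext <;> simp [tauProj_zero, tauProj_one, tauProj_two, tauProj_three, hn.neg_one_zpow, c]
  norm_num

theorem dd_eq_mode (n : ℤ) (hn : Odd n) : dd n hn = mode n d := by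
  apply Subtype.ext
  refine congrArg (loop · n) ?_
  ext <;> simp [tauProj_zero, tauProj_one, tauProj_two, tauProj_three, hn.neg_one_zpow, d]
  norm_num

theorem mode_c_of_even {n : ℤ} (hn : Even n) : mode n c = 0 := by
  rw [← mode_zero n]
  refine mode_congr ?_
  ext <;> simp [tauProj_zero, tauProj_one, tauProj_two, tauProj_three, hn.neg_one_zpow, c]

theorem mode_d_of_even {n : ℤ} (hn : Even n) : mode n d = 0 := by
  rw [← mode_zero n]
  refine mode_congr ?_
  ext <;> simp [tauProj_zero, tauProj_one, tauProj_two, tauProj_three, hn.neg_one_zpow, d]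

theorem mode_eq (n : ℤ) (x : NappiWitten) :
    mode n x = ((x 0 + (-1 : ℂ) ^ n * x 1) / 2) • mode n ((2 : ℂ) • a) + x 2 • mode n c +
      x 3 • mode n d := by
  rw [← mode_smul, ← mode_smul, ← mode_smul, ← mode_add, ← mode_add]
  refine mode_congr ?_
  have h := neg_one_zpow_mul_self n
  ext <;> simp [tauProj_zero, tauProj_one, tauProj_two, tauProj_three, a, c, d]
  linear_combination (-x 1) * h

/-- The bracket of a + (-1)ᵐ b with a + (-1)ⁿ b is ((-1)ⁿ - (-1)ᵐ) c. For m + n even this is zero,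
and so is the projection of c, which allows one formula for all parities. -/
theorem tauProj_lie_two_smul_a (m n : ℤ) :
    tauProj (m + n) ((-2 * (-1 : ℂ) ^ m) • c) =
      ⁅tauProj m ((2 : ℂ) • a), tauProj n ((2 : ℂ) • a)⁆ := by
  have h := neg_one_zpow_mul_self m
  ext <;> simp [lie_def, tauProj_zero, tauProj_one, tauProj_two, tauProj_three, a, c,
    zpow_add₀ (show (-1 : ℂ) ≠ 0 by norm_num)]
  linear_combination ((-1 : ℂ) ^ n) * h

theorem tauProj_lie_d_a {m : ℤ} (hm : Odd m) (n : ℤ) :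
    tauProj (m + n) ((2 : ℂ) • a) = ⁅tauProj m d, tauProj n ((2 : ℂ) • a)⁆ := by
  ext <;> simp [lie_def, tauProj_zero, tauProj_one, tauProj_two, tauProj_three, a, d,
    zpow_add₀ (show (-1 : ℂ) ≠ 0 by norm_num), hm.neg_one_zpow] <;> ring

theorem tauProj_lie_c (m n k : ℤ) (x : NappiWitten) :
    tauProj k 0 = ⁅tauProj m c, tauProj n x⁆ := by
  ext <;> simp [lie_def, tauProj_zero, tauProj_one, tauProj_two, tauProj_three, c]

theorem tauProj_lie_d_d (m n k : ℤ) : tauProj k 0 = ⁅tauProj m d, tauProj n d⁆ := by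
  ext <;> simp [lie_def, tauProj_zero, tauProj_one, tauProj_two, tauProj_three, d]

/-- The algebra `Ĥ₄[τ]` is spanned by `kk` and the modes. -/
theorem eq_top_of_mode_mem {Q : Submodule ℂ twistedNW} (hk : kk ∈ Q) (h : ∀ n x, mode n x ∈ Q) :
    Q = ⊤ := by
  have key : ∀ w : AffineNW, (1 / 2 : ℂ) • (w + tauHat w) ∈ Q.map twistedNW.toSubmodule.subtype := by
    intro w
    have hu : ∀ u : LoopNW, (1 / 2 : ℂ) • (AffineNW.mk u 0 + tauHat (AffineNW.mk u 0)) ∈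
        Q.map twistedNW.toSubmodule.subtype := by
      intro u
      induction u using loop_induction with
      | h0 =>
        rw [mk_zero, map_zero, add_zero, smul_zero]
        exact Submodule.zero_mem _
      | hadd u v hu hv =>
        have : AffineNW.mk (u + v) 0 = AffineNW.mk u 0 + AffineNW.mk v 0 := by
          rw [mk_add_mk, add_zero]
        rw [this, map_add, add_add_add_comm, smul_add]
        exact Submodule.add_mem _ hu hv
      | hs r x m =>
        refine ⟨r • mode m x, Q.smul_mem r (h m x), ?_⟩
        have : AffineNW.mk (r • (AddMonoidAlgebra.single m (1 : ℂ) ⊗ₜ[ℂ] x)) 0 = r • loop x m := by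
          rw [loop, smul_mk, mul_zero]
        rw [this, map_smul tauHat r, tauHat_loop, ← smul_add, smul_comm]
        change r • loop (tauProj m x) m = _
        rw [tauProj_apply, loop_smul, loop_add, loop_smul]
    have hw : w = AffineNW.mk (fst w) 0 + snd w • central := by
      rw [central, smul_mk, mk_add_mk, smul_zero, add_zero, zero_add, mul_one, mk_fst_snd]
    rw [hw, map_add, map_smul, tauHat_central, add_add_add_comm, smul_add]
    refine Submodule.add_mem _ (hu _) ?_
    refine ⟨snd w • kk, Q.smul_mem _ hk, ?_⟩
    change snd w • central = _
    module
  -- A fixed point of `tauHat` is its own average.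
  refine Submodule.eq_top_iff'.2 fun w => ?_
  obtain ⟨q, hq, hqw⟩ := key w
  rw [show tauHat (w : AffineNW) = w from w.2, ← two_smul ℂ, smul_smul] at hqw
  norm_num at hqw
  rwa [← hqw]

/-! ### Values of the character on the modes -/

section Character

variable (ψ : LieAlgebra.LieCharacter ℂ positivePart)

theorem character_mode_of_lie {m n k : ℤ} {x y z : NappiWitten} (hm : 0 < m) (hn : 0 < n)
    (hk : m + n = k) (hpos : 0 < k) (h : tauProj k z = ⁅tauProj m x, tauProj n y⁆) :
    ψ ⟨mode k z, mode_mem_positivePart z hpos⟩ = 0 := by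
  subst hk
  have : (⟨mode (m + n) z, mode_mem_positivePart z hpos⟩ : positivePart) =
      ⁅(⟨mode m x, mode_mem_positivePart x hm⟩ : positivePart),
        (⟨mode n y, mode_mem_positivePart y hn⟩ : positivePart)⁆ := by
    apply Subtype.ext
    rw [LieSubalgebra.coe_bracket, lie_mode_mode h, if_neg (by omega), zero_smul, add_zero]
  rw [this, LieAlgebra.lieCharacter_apply_lie]

theorem character_mode_a {m : ℤ} (hm : 0 < m) :
    ψ ⟨mode m ((2 : ℂ) • a), mode_mem_positivePart _ hm⟩ = if m = 1 then ψ amb1 else 0 := by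
  split_ifs with h
  · subst h
    exact congrArg ψ (Subtype.ext (amb_eq_mode 1 odd_one).symm)
  -- For m > 1, e(m) = [d(1), e(m-1)] is a commutator in the positive part.
  · have := tauProj_lie_d_a odd_one (m - 1)
    rw [add_sub_cancel] at this
    exact character_mode_of_lie ψ one_pos (by omega) (by omega) hm this

theorem character_mode_c (hψ : ψ c1 = 0) {m : ℤ} (hm : 0 < m) :
    ψ ⟨mode m c, mode_mem_positivePart _ hm⟩ = 0 := by
  by_cases h : m = 1
  · subst h
    rw [← hψ]
    exact congrArg ψ (Subtype.ext (cc_eq_mode 1 odd_one).symm)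
  -- For m > 1, c(m) is a nonzero multiple of [e(m-1), e(1)].
  · have h2 := tauProj_lie_two_smul_a (m - 1) 1
    rw [sub_add_cancel] at h2
    have h3 := character_mode_of_lie ψ (by omega) one_pos (by omega) hm h2
    have h4 : (⟨mode m ((-2 * (-1 : ℂ) ^ (m - 1)) • c), mode_mem_positivePart _ hm⟩ : positivePart)
        = (-2 * (-1 : ℂ) ^ (m - 1)) • ⟨mode m c, mode_mem_positivePart _ hm⟩ :=
      Subtype.ext (mode_smul _ _ _)
    rw [h4, map_smul, smul_eq_mul] at h3
    exact (mul_eq_zero.1 h3).resolve_left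
      (mul_ne_zero (by norm_num) (zpow_ne_zero _ (by norm_num)))

end Character

end TwistedNW

/-! ### The action on the Whittaker module -/

section Action

attribute [local instance] LieRing.ofAssociativeRing

open UniversalEnvelopingAlgebra

/-- By the universal property `ι` lifts to a homomorphism into `A`; followed by the inclusion it
agrees with the identity on `L`, hence everywhere. -/
theorem UniversalEnvelopingAlgebra.eq_top_of_ι_mem {L : Type*} [LieRing L] [LieAlgebra ℂ L]
    (A : Subalgebra ℂ (UniversalEnvelopingAlgebra ℂ L)) (h : ∀ x, ι ℂ x ∈ A) : A = ⊤ := by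
  let f : L →ₗ⁅ℂ⁆ A :=
    { toFun := fun x => ⟨ι ℂ x, h x⟩
      map_add' := fun x y => Subtype.ext (map_add _ x y)
      map_smul' := fun r x => Subtype.ext (map_smul _ r x)
      map_lie' := fun {x y} => Subtype.ext (LieHom.map_lie _ x y) }
  have hf : A.val.comp (lift ℂ f) = AlgHom.id ℂ _ := by
    refine UniversalEnvelopingAlgebra.hom_ext ℂ (LieHom.ext fun x => ?_)
    change A.val (lift ℂ f (ι ℂ x)) = ι ℂ x
    rw [lift_ι_apply]
    rfl
  refine Algebra.eq_top_iff.2 fun u => ?_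
  have : A.val (lift ℂ f u) = u := congrArg (fun g => g u) hf
  rw [← this]
  exact (lift ℂ f u).2

variable {V : Type} [AddCommGroup V] [Module ℂ V] [Module (UniversalEnvelopingAlgebra ℂ twistedNW) V]
  [IsScalarTower ℂ (UniversalEnvelopingAlgebra ℂ twistedNW) V]

/-- The action of `Ĥ₄[τ]` on a module over its enveloping algebra. -/
def envelopingAction : twistedNW →ₗ[ℂ] Module.End ℂ V :=
  (Algebra.lsmul ℂ ℂ V).toLinearMap ∘ₗ
    ((ι ℂ : twistedNW →ₗ⁅ℂ⁆ UniversalEnvelopingAlgebra ℂ twistedNW) :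
      twistedNW →ₗ[ℂ] UniversalEnvelopingAlgebra ℂ twistedNW)

/-- The module `V` has level `ξ` and is generated by the vector `w`, on which `Ĥ₄[τ]⁽⁺⁾` acts by
the character `ψ`. -/
structure IsWhittakerGenerated (ψ : LieAlgebra.LieCharacter ℂ positivePart) (ξ : ℂ) (w : V) :
    Prop where
  kk_smul : ∀ v : V, ι ℂ kk • v = ξ • v
  smul_gen : ∀ x : positivePart, ι ℂ (x : twistedNW) • w = ψ x • w
  exists_smul : ∀ v : V, ∃ u : UniversalEnvelopingAlgebra ℂ twistedNW, v = u • w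

variable {ψ : LieAlgebra.LieCharacter ℂ positivePart} {ξ : ℂ} {w₀ : V}

theorem envelopingAction_apply (x : twistedNW) (v : V) :
    envelopingAction x v = ι ℂ x • v := rfl

theorem envelopingAction_comm (x y : twistedNW) (v : V) :
    envelopingAction x (envelopingAction y v) =
      envelopingAction y (envelopingAction x v) + envelopingAction ⁅x, y⁆ v := by
  simp only [envelopingAction_apply, LieHom.map_lie, LieRing.of_associative_ring_bracket, sub_smul,
    mul_smul]
  abel

theorem envelopingAction_mode (hg : IsWhittakerGenerated ψ ξ w₀) {m n : ℤ} {x y z : NappiWitten} {r : ℂ}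
    (h : tauProj (m + n) z = ⁅tauProj m x, tauProj n y⁆)
    (hr : m + n = 0 → form (tauProj m x) (tauProj n y) = r) (v : V) :
    envelopingAction (mode m x) (envelopingAction (mode n y) v) =
      envelopingAction (mode n y) (envelopingAction (mode m x) v) +
        envelopingAction (mode (m + n) z) v + (if m + n = 0 then m * r * ξ else 0) • v := by
  rw [envelopingAction_comm, lie_mode_mode h, map_add, map_smul, LinearMap.add_apply,
    LinearMap.smul_apply, envelopingAction_apply kk, hg.kk_smul, smul_smul, add_assoc]
  split_ifs with h0
  · rw [hr h0]
  · rw [zero_mul]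

/-- The elements of the enveloping algebra that preserve `W` form a subalgebra, and it contains the
Lie algebra because `kk` and the modes span. -/
theorem eq_top_of_mode_stable (hg : IsWhittakerGenerated ψ ξ w₀) (W : Submodule ℂ V) (hω : w₀ ∈ W)
    (h : ∀ n x, ∀ w ∈ W, envelopingAction (mode n x) w ∈ W) : W = ⊤ := by
  let Q : Submodule ℂ twistedNW :=
    { carrier := {x | ∀ w ∈ W, envelopingAction x w ∈ W}
      add_mem' := fun {x y} hx hy w hw => by
        rw [map_add]
        exact W.add_mem (hx w hw) (hy w hw)
      zero_mem' := fun w _ => by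
        rw [map_zero]
        exact W.zero_mem
      smul_mem' := fun r x hx w hw => by
        rw [map_smul]
        exact W.smul_mem r (hx w hw) }
  have hQ : Q = ⊤ := eq_top_of_mode_mem
    (fun w hw => by
      rw [envelopingAction_apply, hg.kk_smul]
      exact W.smul_mem _ hw) h
  let A : Subalgebra ℂ (UniversalEnvelopingAlgebra ℂ twistedNW) :=
    { carrier := {u | ∀ w ∈ W, u • w ∈ W}
      add_mem' := fun {x y} hx hy w hw => by
        rw [add_smul]
        exact W.add_mem (hx w hw) (hy w hw)
      mul_mem' := fun {x y} hx hy w hw => by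
        rw [mul_smul]
        exact hx _ (hy w hw)
      algebraMap_mem' := fun r w hw => by
        rw [algebraMap_smul]
        exact W.smul_mem r hw }
  have hA : A = ⊤ := eq_top_of_ι_mem A fun x => by
    have : x ∈ Q := hQ ▸ Submodule.mem_top
    exact this
  refine Submodule.eq_top_iff'.2 fun v => ?_
  obtain ⟨u, rfl⟩ := hg.exists_smul v
  have : u ∈ A := hA ▸ Algebra.mem_top
  exact this _ hω

/-- A module generated by a Whittaker vector, in terms of operators. -/
def whittakerModule (hg : IsWhittakerGenerated ψ ξ w₀) (hψ : ψ c1 = 0) (hξ : ξ ≠ 0) :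
    CyclicWhittakerModule V where
  e n := envelopingAction (mode n ((2 : ℂ) • a))
  c n := envelopingAction (mode n c)
  d n := envelopingAction (mode n d)
  ω := w₀
  ξ := ξ
  σ := ψ amb1
  χ m := if h : 0 < m then ψ ⟨mode m d, mode_mem_positivePart _ h⟩ else 0
  ξ_ne_zero := hξ
  c_even n hn := by rw [mode_c_of_even hn, map_zero]
  e_e m n v := by
    rw [envelopingAction_mode hg (r := 2 * (-1 : ℂ) ^ m) (tauProj_lie_two_smul_a m n) (fun h => ?_),
      mode_smul (m + n), map_smul envelopingAction, LinearMap.smul_apply]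
    · congr 2
      rw [show (m : ℂ) * (2 * (-1) ^ m) * ξ = 2 * m * (-1) ^ m * ξ by ring]
    · obtain rfl : n = -m := by omega
      have hs : ((-1 : ℂ) ^ m)⁻¹ = (-1) ^ m :=
        inv_eq_of_mul_eq_one_left (neg_one_zpow_mul_self m)
      simp [form_apply, tauProj_zero, tauProj_one, tauProj_two, tauProj_three, a, hs]
      ring
  c_e m n v := by
    rw [envelopingAction_mode hg (r := 0) (tauProj_lie_c m n _ _) (fun h => ?_), mode_zero, map_zero]
    · simp
    · simp [form_apply, tauProj_zero, tauProj_one, tauProj_two, tauProj_three, a, c]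
  c_c m n v := by
    rw [envelopingAction_mode hg (r := 0) (tauProj_lie_c m n _ _) (fun h => ?_), mode_zero, map_zero]
    · simp
    · simp [form_apply, tauProj_zero, tauProj_one, tauProj_two, tauProj_three, c]
  d_d m n v _ _ := by
    rw [envelopingAction_mode hg (r := 0) (tauProj_lie_d_d m n _) (fun h => ?_), mode_zero, map_zero]
    · simp
    · simp [form_apply, tauProj_zero, tauProj_one, tauProj_two, tauProj_three, d]
  d_e m n v hm := by
    rw [envelopingAction_mode hg (r := 0) (tauProj_lie_d_a hm n) (fun h => ?_)]
    · simp
    · simp [form_apply, tauProj_zero, tauProj_one, tauProj_two, tauProj_three, a, d]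
  c_d m n v hn := by
    rw [envelopingAction_mode hg (r := 1) (tauProj_lie_c m n _ _) (fun h => ?_), mode_zero, map_zero]
    · simp
    · obtain rfl : m = -n := by omega
      simp [form_apply, tauProj_zero, tauProj_one, tauProj_two, tauProj_three, c, d,
        hn.neg_one_zpow]
      norm_num
  e_ω m hm := by
    rw [← character_mode_a ψ hm]
    exact hg.smul_gen ⟨_, mode_mem_positivePart _ hm⟩
  c_ω m hm := by
    rw [← zero_smul ℂ w₀, ← character_mode_c ψ hψ hm]
    exact hg.smul_gen ⟨_, mode_mem_positivePart _ hm⟩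
  d_ω m _ hm := by
    rw [dif_pos hm]
    exact hg.smul_gen ⟨_, mode_mem_positivePart _ hm⟩
  cyclic W hω he hc hd := by
    refine eq_top_of_mode_stable hg W hω fun n x w hw => ?_
    have hd' : envelopingAction (mode n d) w ∈ W := by
      rcases Int.even_or_odd n with hn | hn
      · rw [mode_d_of_even hn, map_zero]
        exact W.zero_mem
      · exact hd n hn w hw
    rw [mode_eq n x, map_add, map_add, map_smul, map_smul, map_smul]
    exact W.add_mem (W.add_mem (W.smul_mem _ (he n w hw)) (W.smul_mem _ (hc n w hw)))
      (W.smul_mem _ hd')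

theorem isWhittakerVector_iff (hg : IsWhittakerGenerated ψ ξ w₀) (hψ : ψ c1 = 0) (hξ : ξ ≠ 0) (v : V) :
    IsWhittakerVector ψ v ↔ v ≠ 0 ∧ ∀ m : ℤ, 0 < m → (whittakerModule hg hψ hξ).eShift m v = 0 ∧
      (whittakerModule hg hψ hξ).c m v = 0 ∧ (Odd m → (whittakerModule hg hψ hξ).dShift m v = 0) := by
  have he : ∀ m : ℤ, (hm : 0 < m) → ((whittakerModule hg hψ hξ).eShift m v = 0 ↔
      ι ℂ (mode m ((2 : ℂ) • a)) • v =
        ψ ⟨mode m ((2 : ℂ) • a), mode_mem_positivePart _ hm⟩ • v) := by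
    intro m hm
    rw [character_mode_a ψ hm, CyclicWhittakerModule.eShift_apply, sub_eq_zero]
    rfl
  have hc : ∀ m : ℤ, (hm : 0 < m) → ((whittakerModule hg hψ hξ).c m v = 0 ↔
      ι ℂ (mode m c) • v = ψ ⟨mode m c, mode_mem_positivePart _ hm⟩ • v) := by
    intro m hm
    rw [character_mode_c ψ hψ hm, zero_smul]
    rfl
  have hd : ∀ m : ℤ, (hm : 0 < m) → ((whittakerModule hg hψ hξ).dShift m v = 0 ↔
      ι ℂ (mode m d) • v = ψ ⟨mode m d, mode_mem_positivePart _ hm⟩ • v) := by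
    intro m hm
    rw [CyclicWhittakerModule.dShift_apply, sub_eq_zero]
    simp only [whittakerModule, dif_pos hm]
    rfl
  refine and_congr_right fun _ => ⟨fun h m hm => ⟨(he m hm).2 (h ⟨_, _⟩), (hc m hm).2 (h ⟨_, _⟩),
    fun _ => (hd m hm).2 (h ⟨_, _⟩)⟩, fun h => ?_⟩
  rintro ⟨x, hx⟩
  change x ∈ Submodule.span ℂ {w | IsPositiveGenerator w} at hx
  change ι ℂ x • v = ψ ⟨x, hx⟩ • v
  induction hx using Submodule.span_induction with
  | mem x hx =>
    cases hx with
    | apb n hn hpos => simpa only [apb_eq_mode] using (he n hpos).1 (h n hpos).1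
    | amb n hn hpos => simpa only [amb_eq_mode] using (he n hpos).1 (h n hpos).1
    | cc n hn hpos => simpa only [cc_eq_mode] using (hc n hpos).1 (h n hpos).2.1
    | dd n hn hpos => simpa only [dd_eq_mode] using (hd n hpos).1 ((h n hpos).2.2 hn)
  | zero =>
    have : ψ ⟨0, positivePart.zero_mem⟩ = 0 := map_zero ψ
    rw [map_zero, zero_smul]
    exact (this ▸ zero_smul ℂ v).symm
  | add x y hx hy ihx ihy =>
    have : ψ ⟨x + y, positivePart.add_mem hx hy⟩ = ψ ⟨x, hx⟩ + ψ ⟨y, hy⟩ :=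
      map_add ψ (⟨x, hx⟩ : positivePart) ⟨y, hy⟩
    rw [map_add, add_smul, ihx, ihy, ← add_smul]
    exact congrArg (· • v) this.symm
  | smul r x hx ihx =>
    have : ψ ⟨r • x, positivePart.smul_mem r hx⟩ = r • ψ ⟨x, hx⟩ :=
      map_smul ψ r (⟨x, hx⟩ : positivePart)
    rw [map_smul, smul_assoc, ihx, ← smul_assoc]
    exact congrArg (· • v) this.symm

/-- Forwards, each step of the extension is a Horner step u ↦ r + z u on polynomials. -/
theorem mem_zSpan_iff_exists (hg : IsWhittakerGenerated ψ ξ w₀) (hψ : ψ c1 = 0) (hξ : ξ ≠ 0) {α β : ℂ}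
    {z : UniversalEnvelopingAlgebra ℂ twistedNW}
    (hz : ∀ v, (whittakerModule hg hψ hξ).zOp α β v = z • v) (v : V) :
    v ∈ (whittakerModule hg hψ hξ).zSpan α β ↔ ∃ u ∈ Algebra.adjoin ℂ {z}, v = u • w₀ := by
  constructor
  · refine OperatorChain.extend_induction
      (p := fun v => ∃ u ∈ Algebra.adjoin ℂ {z}, v = u • w₀) (fun w hw => ?_) (fun w hw u _ hu => ?_)
    · obtain ⟨r, rfl⟩ := Submodule.mem_span_singleton.1 hw
      exact ⟨algebraMap ℂ _ r, Subalgebra.algebraMap_mem _ r, (algebraMap_smul _ r _).symm⟩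
    · obtain ⟨r, rfl⟩ := Submodule.mem_span_singleton.1 hw
      obtain ⟨u, hu, rfl⟩ := hu
      refine ⟨algebraMap ℂ _ r + z * u, Subalgebra.add_mem _ (Subalgebra.algebraMap_mem _ r)
        (Subalgebra.mul_mem _ (Algebra.self_mem_adjoin_singleton ℂ z) hu), ?_⟩
      rw [hz, add_smul, mul_smul, algebraMap_smul]
      rfl
  · rintro ⟨u, hu, rfl⟩
    have hω : w₀ ∈ (whittakerModule hg hψ hξ).zSpan α β :=
      OperatorChain.le_extend (Submodule.mem_span_singleton_self _)
    have key : ∀ w ∈ (whittakerModule hg hψ hξ).zSpan α β,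
        u • w ∈ (whittakerModule hg hψ hξ).zSpan α β := by
      induction hu using Algebra.adjoin_induction with
      | mem x hx =>
        intro w hw
        rw [Set.mem_singleton_iff.1 hx, ← hz]
        exact CyclicWhittakerModule.zOp_zSpan hw
      | algebraMap r =>
        intro w hw
        rw [algebraMap_smul]
        exact Submodule.smul_mem _ _ hw
      | add x y _ _ hx hy =>
        intro w hw
        rw [add_smul]
        exact Submodule.add_mem _ (hx w hw) (hy w hw)
      | mul x y _ _ hx hy =>
        intro w hw
        rw [mul_smul]
        exact hx _ (hy w hw)
    exact key _ hω

theorem isWhittakerVector_iff_exists_adjoin (hg : IsWhittakerGenerated ψ ξ w₀) (hψ : ψ c1 = 0)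
    (hξ : ξ ≠ 0) (v : V) :
    IsWhittakerVector ψ v ↔
      v ≠ 0 ∧ ∃ u ∈ Algebra.adjoin ℂ {whittakerZ ψ ξ}, v = u • w₀ := by
  rw [isWhittakerVector_iff hg hψ hξ]
  refine and_congr_right fun _ => ?_
  by_cases hσ : ψ amb1 = 0
  -- Both cases of z solve ασ₁ = βξ with α ≠ 0: here (α, β) = (1, 0), and (ξ, σ₁) if σ₁ ≠ 0.
  · rw [← CyclicWhittakerModule.mem_zSpan_iff (α := 1) (β := 0) one_ne_zero]
    · refine mem_zSpan_iff_exists hg hψ hξ (fun w => ?_) v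
      rw [whittakerZ, if_pos hσ, CyclicWhittakerModule.zOp_apply, one_smul, zero_smul, sub_zero,
        apb_eq_mode]
      rfl
    · rw [one_mul, zero_mul]
      exact hσ
  · rw [← CyclicWhittakerModule.mem_zSpan_iff (α := ξ) (β := ψ amb1) hξ (mul_comm _ _)]
    refine mem_zSpan_iff_exists hg hψ hξ (fun w => ?_) v
    rw [whittakerZ, if_neg hσ, CyclicWhittakerModule.zOp_apply, sub_smul, smul_assoc, smul_assoc,
      apb_eq_mode, cc_eq_mode]
    rfl

/-! ### The module `L_{ψ,ξ}` is generated by a vector of type ψ -/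

theorem kk_smul_whittakerQuotient (v : WhittakerQuotient ψ ξ) : ι ℂ kk • v = ξ • v := by
  obtain ⟨m, rfl⟩ := Submodule.Quotient.mk_surjective _ v
  rw [← sub_eq_zero,
    ← algebraMap_smul (UniversalEnvelopingAlgebra ℂ twistedNW) ξ, ← sub_smul]
  exact (Submodule.Quotient.mk_eq_zero _).2 (Submodule.subset_span ⟨m, rfl⟩)

theorem ι_smul_omegaBar (x : positivePart) :
    ι ℂ (x : twistedNW) • omegaBar ψ ξ = ψ x • omegaBar ψ ξ := by
  have h : (1 * envelopingIncl positivePart (ι ℂ x)) ⊗ₜ[ℂ] (1 : ℂ) -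
      (1 : UniversalEnvelopingAlgebra ℂ twistedNW) ⊗ₜ[ℂ] (characterAction ψ (ι ℂ x) * 1) ∈
      balancedRelations ψ := Submodule.subset_span ⟨1, ι ℂ x, 1, rfl⟩
  have h2 := congrArg (fun w => (Submodule.Quotient.mk w : WhittakerQuotient ψ ξ))
    ((Submodule.Quotient.eq _).2 h)
  have e1 : envelopingIncl positivePart (ι ℂ x) = ι ℂ (x : twistedNW) := by
    rw [envelopingIncl, lift_ι_apply]
    rfl
  have e2 : characterAction ψ (ι ℂ x) = ψ x := by rw [characterAction, lift_ι_apply]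
  have e3 : (1 : UniversalEnvelopingAlgebra ℂ twistedNW) ⊗ₜ[ℂ] (ψ x * 1) =
      ψ x • ((1 : UniversalEnvelopingAlgebra ℂ twistedNW) ⊗ₜ[ℂ] (1 : ℂ)) := by
    rw [← TensorProduct.tmul_smul, smul_eq_mul]
  have e4 : (1 * ι ℂ (x : twistedNW)) ⊗ₜ[ℂ] (1 : ℂ) = ι ℂ (x : twistedNW) •
      ((1 : UniversalEnvelopingAlgebra ℂ twistedNW) ⊗ₜ[ℂ] (1 : ℂ)) := by
    rw [TensorProduct.smul_tmul', smul_eq_mul, one_mul, mul_one]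
  rw [e1, e2, e3, e4] at h2
  exact h2

theorem exists_smul_omegaBar (v : WhittakerQuotient ψ ξ) :
    ∃ u : UniversalEnvelopingAlgebra ℂ twistedNW, v = u • omegaBar ψ ξ := by
  obtain ⟨m, rfl⟩ := Submodule.Quotient.mk_surjective _ v
  obtain ⟨m, rfl⟩ := Submodule.Quotient.mk_surjective _ m
  induction m using TensorProduct.induction_on with
  | zero => exact ⟨0, by rw [zero_smul]; rfl⟩
  | add m n hm hn =>
    obtain ⟨u, hu⟩ := hm
    obtain ⟨w, hw⟩ := hn
    refine ⟨u + w, ?_⟩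
    rw [add_smul, ← hu, ← hw]
    rfl
  | tmul u r =>
    refine ⟨r • u, ?_⟩
    have : u ⊗ₜ[ℂ] r = (r • u) • ((1 : UniversalEnvelopingAlgebra ℂ twistedNW) ⊗ₜ[ℂ] (1 : ℂ)) := by
      rw [TensorProduct.smul_tmul', smul_eq_mul, mul_one, ← TensorProduct.smul_tmul', ←
        TensorProduct.tmul_smul, smul_eq_mul, mul_one]
    rw [this]
    rfl

theorem isWhittakerGenerated_omegaBar (ψ : LieAlgebra.LieCharacter ℂ positivePart) (ξ : ℂ) :
    IsWhittakerGenerated ψ ξ (omegaBar ψ ξ) :=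
  ⟨kk_smul_whittakerQuotient, ι_smul_omegaBar, exists_smul_omegaBar⟩

end Action

end

theorem theorem5p3 (ψ : LieAlgebra.LieCharacter ℂ TwistedNW.positivePart)
    (hψ : ψ TwistedNW.c1 = 0) (ξ : ℂ) (hξ : ξ ≠ 0) (v : WhittakerQuotient ψ ξ) :
    IsWhittakerVector ψ v ↔
      v ≠ 0 ∧ ∃ u ∈ Algebra.adjoin ℂ {whittakerZ ψ ξ}, v = u • omegaBar ψ ξ :=
  isWhittakerVector_iff_exists_adjoin (isWhittakerGenerated_omegaBar ψ ξ) hψ hξ v
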